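/- Setting. Let $\mathsf N\ge 0$, let $2s_n\in\mathbb Z_{>0}$ for $1\le n\le \mathsf N$, let $\eta\in\mathbb C\setminus\{0\}$, and put $\mathcal H=\bigotimes_{n=1}^{\mathsf N}V_n$ with $V_n=\mathbb C^{2s_n+1}$. On $V_n$ let $S^z_n=\mathrm{diag}(s_n,s_n-1,\dots,-s_n)$, let $S^+_n$ have the superdiagonal entries $\sqrt{j(2s_n+1-j)}$, $1\le j\le 2s_n$, and zeros elsewhere, and let $S^-_n=(S^+_n)^t$. For $K\in\mathrm{End}(\mathbb C^2)$ and $\xi=(\xi_1,\dots,\xi_{\mathsf N})\in\mathbb C^{\mathsf N}$ define, on $\mathbb C^2\otimes\mathcal H$, $$\mathsf L_{0n}(\lambda)=\begin{pmatrix}\lambda+\eta(\tfrac12+S^z_n)&\eta S^-_n\\ \eta S^+_n&\lambda+\eta(\tfrac12-S^z_n)\end{pmatrix},\qquad \mathsf M_0^{(K)}(\lambda)=K_0\,\mathsf L_{0\mathsf N}(\lambda-\xi_{\mathsf N})\cdots\mathsf L_{01}(\lambda-\xi_1),$$ and $\mathsf T^{(K)}(\lambda)=\mathrm{tr}_0\,\mathsf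 M_0^{(K)}(\lambda)$. For $a\ge1$ let $P^+$ be the symmetric projector on $(\mathbb C^2)^{\otimes a}$, with range $V^+_{1\dots a}\simeq\mathbb C^{a+1}$ (identified as spin-$a/2$ representations), and let $$\mathsf T^{(K|a)}(\lambda)=\mathrm{tr}_{V^+_{1\dots a}}\,P^+\,\mathsf M^{(K)}_1(\lambda+(a-1)\eta)\cdots\mathsf M^{(K)}_{a-1}(\lambda+\eta)\,\mathsf M^{(K)}_a(\lambda)\,P^+,\qquad K^{(a)}=P^+K_1\cdots K_a P^+\in\mathrm{End}(\mathbb C^{a+1}).$$ Put $\xi_n^{(k)}=\xi_n-\eta/2+(s_n-k)\eta$. "For almost any" choice of some complex parameters means: outside the zero set of some nonzero polynomial in these parameters. For a covector $\langle S|$ of $\mathcal H$ consider the covectors $$\langle S|\prod_{n=1}^{\mathsf N}\bigl(\mathsf T^{(K|2s_n)}(\xi_n^{(2s_n-1)})\bigr)^{h_n},\qquad h_n\in\{0,\dots,2s_n\}. \tag{1}$$ Proposition. Let $K$ be diagonalizable, invertible, and with simple spectrum, i.e. with distinct nonzero eigenvalues $\mathsf k_1\ne\mathsf k_2$. In the following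 the $\xi_n$ are always subject to $\xi_a\ne\xi_b+k\eta$ for all $a\ne b$ and all $k\in\mathbb Z$. (i) Assume that $\mathsf k_1^j\neq\mathsf k_2^j$ for all $n$ and all $1\le j\le 2s_n$ (i.e. that every $K^{(2s_n)}$ has simple spectrum). Then for almost any choice of $(\xi,\langle S|)$ the covectors (1) form a basis of the space of covectors of $\mathcal H$. Moreover, for each $n$ there is a covector $\langle S,n|$ of $V_n$ such that $\langle S,n|(K^{(2s_n)})^h$, $h\in\{0,\dots,2s_n\}$, form a covector basis of $V_n$. (ii) If $\langle S|=\bigotimes_n\langle S,n|$, where for every $n$ the covectors $\langle S,n|(K^{(2s_n)})^h$, $h\in\{0,\dots,2s_n\}$, form a covector basis of $V_n$, then for almost any choice of $\xi$ the covectors (1) form a basis of the space of covectors of $\mathcal H$. (iii) For almost any choice of $\xi$, the transfer matrix $\mathsf T^{(K)}(\lambda)$ is diagonalizable with simple spectrum: $\mathcal H$ has a basis of common eigenvectors of all $\mathsf T^{(K)}(\lambda)$, $\lambda\in\mathbb C$, whose eigenvalues are pairwise distinct polynomials in $\lambda$. -/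

import Mathlib

open Matrix Polynomial

noncomputable section

namespace HigherSpin

/-- The operator `A_i` on the tensor product `⨂_j ℂ^{X j}` (with basis indexed by `∀ j, X j`):
it acts as `A` on the factor `i` and as the identity on all the other factors.  The entries of `A`
may lie in a noncommutative ring `R` of operators on a further space. -/
def actOn {ι : Type} [Fintype ι] [DecidableEq ι] {X : ι → Type} [∀ i, DecidableEq (X i)]
    {R : Type} [Zero R] (i : ι) (A : Matrix (X i) (X i) R) :
    Matrix (∀ j, X j) (∀ j, X j) R :=
  Matrix.of fun f g => if ∀ j, j ≠ i → f j = g j then A (f i) (g i) else 0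

/-! ### The spin `s = m / 2` representation on `ℂ^{m+1}` -/

/-- `S^z = diag (s, s - 1, …, -s)`, with `2 s = m`. -/
def spinZ (m : ℕ) : Matrix (Fin (m + 1)) (Fin (m + 1)) ℂ :=
  Matrix.diagonal fun j => (m : ℂ) / 2 - (j : ℕ)

/-- `S^+`: upper triangular with superdiagonal `x 1, …, x m`, where `x j = √(j (m + 1 - j))`. -/
def spinPlus (m : ℕ) : Matrix (Fin (m + 1)) (Fin (m + 1)) ℂ :=
  Matrix.of fun i j =>
    if (i : ℕ) + 1 = (j : ℕ) then
      ((Real.sqrt (((j : ℕ) : ℝ) * ((m : ℝ) + 1 - ((j : ℕ) : ℝ))) : ℝ) : ℂ)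
    else 0

/-- `S^-` is the transpose of `S^+`. -/
def spinMinus (m : ℕ) : Matrix (Fin (m + 1)) (Fin (m + 1)) ℂ := (spinPlus m)ᵀ

/-! ### The chain -/

/-- Index set of the natural basis of the quantum space `⨂_n ℂ^{2 s_n + 1}`, where
`p n = 2 s_n`. -/
abbrev Idx {N : ℕ} (p : Fin N → ℕ) : Type := ∀ n : Fin N, Fin (p n + 1)

/-- Operators on the quantum space. -/
abbrev Op {N : ℕ} (p : Fin N → ℕ) : Type := Matrix (Idx p) (Idx p) ℂ

/-- The Lax operator of site `n`, a `2 × 2` matrix (auxiliary space) of operators on the quantum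
space. -/
def lax {N : ℕ} (p : Fin N → ℕ) (η : ℂ) (n : Fin N) (μ : ℂ) :
    Matrix (Fin 2) (Fin 2) (Op p) :=
  !![actOn n ((μ + η / 2) • (1 : Matrix (Fin (p n + 1)) (Fin (p n + 1)) ℂ) + η • spinZ (p n)),
      actOn n (η • spinMinus (p n));
    actOn n (η • spinPlus (p n)),
      actOn n ((μ + η / 2) • (1 : Matrix (Fin (p n + 1)) (Fin (p n + 1)) ℂ) - η • spinZ (p n))]

/-- The monodromy matrix `K_0 L_{0N}(μ - ξ_N) ⋯ L_{01}(μ - ξ_1)`. -/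
def monodromy {N : ℕ} (p : Fin N → ℕ) (η : ℂ) (K : Matrix (Fin 2) (Fin 2) ℂ) (ξ : Fin N → ℂ)
    (μ : ℂ) : Matrix (Fin 2) (Fin 2) (Op p) :=
  K.map (fun c => c • (1 : Op p)) *
    (List.ofFn fun n : Fin N => lax p η n (μ - ξ n)).reverse.prod

/-- The transfer matrix `T^{(K)}(μ)`: the trace of the monodromy matrix over the auxiliary
space. -/
def transfer {N : ℕ} (p : Fin N → ℕ) (η : ℂ) (K : Matrix (Fin 2) (Fin 2) ℂ) (ξ : Fin N → ℂ)
    (μ : ℂ) : Op p :=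
  (monodromy p η K ξ μ).trace

/-! ### Fusion -/

/-- The permutation operator
`v_1 ⊗ ⋯ ⊗ v_a ↦ v_{π 1} ⊗ ⋯ ⊗ v_{π a}` on `(ℂ²)^{⊗ a}`. -/
def permOp (a : ℕ) (π : Equiv.Perm (Fin a)) : Matrix (Fin a → Fin 2) (Fin a → Fin 2) ℂ :=
  Matrix.of fun f g => if f = g ∘ π then 1 else 0

/-- The symmetric projector `P⁺` on `(ℂ²)^{⊗ a}`. -/
def symProj (a : ℕ) : Matrix (Fin a → Fin 2) (Fin a → Fin 2) ℂ :=
  ((a.factorial : ℂ)⁻¹) • ∑ π : Equiv.Perm (Fin a), permOp a π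

/-- The fused monodromy matrix
`P⁺ M_1(μ + (a-1) η) ⋯ M_{a-1}(μ + η) M_a(μ) P⁺`. -/
def fusedMonodromy {N : ℕ} (p : Fin N → ℕ) (η : ℂ) (K : Matrix (Fin 2) (Fin 2) ℂ)
    (ξ : Fin N → ℂ) (a : ℕ) (μ : ℂ) : Matrix (Fin a → Fin 2) (Fin a → Fin 2) (Op p) :=
  (symProj a).map (fun c => c • (1 : Op p)) *
    (List.ofFn fun i : Fin a =>
      actOn (X := fun _ => Fin 2) i
        (monodromy p η K ξ (μ + ((a : ℂ) - 1 - ((i : ℕ) : ℂ)) * η))).prod *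
    (symProj a).map (fun c => c • (1 : Op p))

/-- The fused transfer matrix `T^{(K|a)}(μ)`.  The fused monodromy matrix vanishes on the kernel
of `P⁺` and has its range in that of `P⁺`, so its trace over `(ℂ²)^{⊗ a}` is its trace over the
range of `P⁺`. -/
def fusedTransfer {N : ℕ} (p : Fin N → ℕ) (η : ℂ) (K : Matrix (Fin 2) (Fin 2) ℂ)
    (ξ : Fin N → ℂ) (a : ℕ) (μ : ℂ) : Op p :=
  (fusedMonodromy p η K ξ a μ).trace

/-- The unitary identification of `ℂ^{a+1}` with the symmetric part of `(ℂ²)^{⊗ a}`: the basis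
vector `e_j` (of `S^z`-weight `a / 2 - j`) is sent to the normalised sum of the tensors with
exactly `j` lower components.  It intertwines the `sl(2)` actions, with the above matrices
on `ℂ^{a+1}`. -/
def symIso (a : ℕ) : Matrix (Fin a → Fin 2) (Fin (a + 1)) ℂ :=
  Matrix.of fun f j =>
    if (∑ i, (f i : ℕ)) = (j : ℕ) then
      (((Real.sqrt ((a.choose (j : ℕ) : ℕ) : ℝ))⁻¹ : ℝ) : ℂ)
    else 0

/-- The fused twist `K^{(a)} = P⁺ K_1 ⋯ K_a P⁺`, as a matrix on `ℂ^{a+1}`. -/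
def fusedTwist (K : Matrix (Fin 2) (Fin 2) ℂ) (a : ℕ) : Matrix (Fin (a + 1)) (Fin (a + 1)) ℂ :=
  (symIso a)ᵀ *
    (symProj a * (List.ofFn fun i : Fin a => actOn (X := fun _ => Fin 2) i K).prod * symProj a) *
    symIso a

/-! ### The covectors -/

/-- A family of covectors (row vectors) is a basis of the space of all covectors. -/
def IsCovectorBasis {ι κ : Type} (v : κ → ι → ℂ) : Prop :=
  LinearIndependent ℂ v ∧ Submodule.span ℂ (Set.range v) = ⊤

/-- `ξ^{(k)} = ξ - η / 2 + (s - k) η`, where `2 s = m`. -/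
def shifted (η x : ℂ) (m : ℕ) (k : ℤ) : ℂ := x - η / 2 + ((m : ℂ) / 2 - (k : ℂ)) * η

/-- The covectors `⟨S| ∏_n (T^{(K|2 s_n)}(ξ_n^{(2 s_n - 1)}))^{h_n}`; the (mutually commuting)
factors are written in the order `n = 1, …, N`. -/
def sovCovector {N : ℕ} (p : Fin N → ℕ) (η : ℂ) (K : Matrix (Fin 2) (Fin 2) ℂ) (ξ : Fin N → ℂ)
    (S : Idx p → ℂ) (h : Idx p) : Idx p → ℂ :=
  S ᵥ* (List.ofFn fun n : Fin N =>
    fusedTransfer p η K ξ (p n) (shifted η (ξ n) (p n) ((p n : ℤ) - 1)) ^ (h n : ℕ)).prod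

/-- The tensor product covector `⨂_n ⟨S, n|`. -/
def tensorCovector {N : ℕ} {p : Fin N → ℕ} (S : ∀ n : Fin N, Fin (p n + 1) → ℂ) :
    Idx p → ℂ :=
  fun f => ∏ n, S n (f n)

/-- The local covector `⟨S|` is such that `⟨S| (K^{(m)})^h`, `0 ≤ h ≤ m`, is a covector basis of
`ℂ^{m+1}`. -/
def IsLocalGenerator (K : Matrix (Fin 2) (Fin 2) ℂ) (m : ℕ) (S : Fin (m + 1) → ℂ) : Prop :=
  IsCovectorBasis fun h : Fin (m + 1) => S ᵥ* fusedTwist K m ^ (h : ℕ)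

/-- `ξ_i ≠ ξ_j mod η` for `i ≠ j`. -/
def DistinctMod {N : ℕ} (η : ℂ) (ξ : Fin N → ℂ) : Prop :=
  ∀ i j : Fin N, i ≠ j → ∀ k : ℤ, ξ i ≠ ξ j + (k : ℂ) * η

/-- The polynomial family of operators `T μ` is diagonalizable with simple spectrum: there is a
basis of common eigenvectors, whose eigenvalues are pairwise distinct polynomials in `μ`. -/
def IsDiagonalizableSimple {ι : Type} [Fintype ι] (T : ℂ → Matrix ι ι ℂ) : Prop :=
  ∃ (b : Module.Basis ι ℂ (ι → ℂ)) (t : ι → ℂ[X]),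
    (∀ i μ, T μ *ᵥ b i = (t i).eval μ • b i) ∧ Function.Injective t

end HigherSpin

end

noncomputable section

namespace HigherSpin

/-! ### Lists of operators and tensor products of matrices -/

/-! Each claim is detected by the nonvanishing of a quantity polynomial in the parameters, so one
nonvanishing point suffices. `IsPoly` records polynomial dependence. The point comes from a
degeneration: for inhomogeneities of order `s⁻¹`, a rescaled quantity extends polynomially to `s =
0`. It is computable and nonzero there, hence nonzero at some `s ≠ 0` (`IsPoly.exists_ne_zero`).

For the covectors the quantity is the determinant `sovDet`, at `ξ_k = k / s`. Seen from site `n`,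
the Lax operators of the other sites become scalars, and the fused transfer matrix reduces to a
one-site trace (`exists_scaled_fusedTransfer`). This trace is `η ^ m * m!` times the fused twist
(`fused_siteLax`). To see it, realize spin `m / 2` on binary forms of degree `m`, with generators
`x_β ∂_α`. At the special point the shifts of the fused factors are exactly those of a Capelli
product, which is therefore normally ordered: `m` derivatives reduce the form to a constant, and
multiplication by variables rebuilds its image under the twist. The limiting determinant is thus, up
to nonzero factors, that of a tensor product of invertible local matrices. Local generators exist
because the fused twist acts by linear substitution, with products of linear eigenforms as
eigenvectors (`hasSimpleSpectrum_fusedTwist`).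

For the spectrum the quantity is the Hankel determinant of the traces of powers of the transfer
matrix at `0`, nonzero exactly when the spectrum is simple. With `ξ_n = -1 / (z_n s)` the transfer
matrix is, up to a factor, a scalar plus `s` times an operator whose limit is a weighted sum of
one-site operators. Their eigenvalues form arithmetic progressions, which weights `z_n` taken as
powers of a large base keep apart (`exists_hasSimpleSpectrum_transfer`). Commutativity, from the
exchange relation, carries the eigenbasis at `0` to every spectral parameter. -/

lemma List.prod_ofFn_eq_single {M : Type*} [Monoid M] {n : ℕ} (k : Fin n) (f : Fin n → M)
    (hf : ∀ i, i ≠ k → f i = 1) : (List.ofFn f).prod = f k := by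
  rw [List.ofFn_eq_map, List.prod_map_eq_pow_single k f (fun a ha _ => hf a ha),
    List.count_eq_one_of_mem (List.nodup_finRange n) (List.mem_finRange k), pow_one]

lemma List.prod_reverse_ofFn_eq_single {M : Type*} [Monoid M] {n : ℕ} (k : Fin n) (f : Fin n → M)
    (hf : ∀ i, i ≠ k → f i = 1) : (List.ofFn f).reverse.prod = f k := by
  rw [List.ofFn_eq_map, ← List.map_reverse,
    List.prod_map_eq_pow_single k f (fun a ha _ => hf a ha), List.count_reverse,
    List.count_eq_one_of_mem (List.nodup_finRange n) (List.mem_finRange k), pow_one]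

lemma List.prod_map_smul_algebra {A ι : Type*} [Ring A] [Algebra ℂ A] (l : List ι) (c : ι → ℂ)
    (f : ι → A) : (l.map fun i => c i • f i).prod = (l.map c).prod • (l.map f).prod := by
  induction l with
  | nil => simp
  | cons a l ih => simp [ih, mul_smul]; rw [smul_comm]

lemma List.prod_ofFn_smul {A : Type*} [Ring A] [Algebra ℂ A] {n : ℕ} (c : Fin n → ℂ)
    (f : Fin n → A) : (List.ofFn fun i => c i • f i).prod = (∏ i, c i) • (List.ofFn f).prod := by
  rw [List.ofFn_eq_map, List.ofFn_eq_map, List.prod_map_smul_algebra, ← List.ofFn_eq_map,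
    List.prod_ofFn]

lemma List.prod_reverse_ofFn_smul {A : Type*} [Ring A] [Algebra ℂ A] {n : ℕ} (c : Fin n → ℂ)
    (f : Fin n → A) :
    (List.ofFn fun i => c i • f i).reverse.prod = (∏ i, c i) • (List.ofFn f).reverse.prod := by
  rw [List.ofFn_eq_map, List.ofFn_eq_map, ← List.map_reverse, List.prod_map_smul_algebra,
    ← List.map_reverse]
  congr 1
  rw [List.map_reverse, List.prod_reverse, ← List.ofFn_eq_map, List.prod_ofFn]

section Tensor

variable {N : ℕ} {p : Fin N → ℕ}

/-- The tensor product of local operators. -/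
def tensorOp (A : ∀ n, Matrix (Fin (p n + 1)) (Fin (p n + 1)) ℂ) : Op p :=
  Matrix.of fun f g => ∏ n, A n (f n) (g n)

lemma tensorOp_mul (A B : ∀ n, Matrix (Fin (p n + 1)) (Fin (p n + 1)) ℂ) :
    tensorOp (A * B) = tensorOp A * tensorOp B := by
  ext f g
  simp only [tensorOp, of_apply, Matrix.mul_apply, Pi.mul_apply, Finset.prod_univ_sum,
    Fintype.piFinset_univ, Finset.prod_mul_distrib]

lemma tensorOp_one : tensorOp (1 : ∀ n, Matrix (Fin (p n + 1)) (Fin (p n + 1)) ℂ) = 1 := by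
  ext f g
  simp only [tensorOp, of_apply, Pi.one_apply, Matrix.one_apply]
  by_cases h : f = g
  · simp [h]
  · obtain ⟨n, hn⟩ := Function.ne_iff.1 h
    rw [if_neg h]
    exact Finset.prod_eq_zero (Finset.mem_univ n) (by simp [hn])

/-- The tensor product of local operators as a monoid homomorphism. -/
def tensorHom : (∀ n, Matrix (Fin (p n + 1)) (Fin (p n + 1)) ℂ) →* Op p where
  toFun := tensorOp
  map_one' := tensorOp_one
  map_mul' := tensorOp_mul

lemma isUnit_tensorOp {A : ∀ n, Matrix (Fin (p n + 1)) (Fin (p n + 1)) ℂ}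
    (hA : ∀ n, IsUnit (A n)) : IsUnit (tensorOp A) :=
  (Pi.isUnit_iff.2 hA).map tensorHom

lemma tensorCovector_vecMul (S : ∀ n, Fin (p n + 1) → ℂ)
    (A : ∀ n, Matrix (Fin (p n + 1)) (Fin (p n + 1)) ℂ) :
    tensorCovector S ᵥ* tensorOp A = tensorCovector fun n => S n ᵥ* A n := by
  ext g
  simp only [tensorCovector, tensorOp, Matrix.vecMul, dotProduct, of_apply, Finset.prod_univ_sum,
    Fintype.piFinset_univ, Finset.prod_mul_distrib]

/-- Padding with identities reduces products and commutation of one-site operators to the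
componentwise monoid structure. -/
lemma actOn_eq_tensorOp (n : Fin N) (A : Matrix (Fin (p n + 1)) (Fin (p n + 1)) ℂ) :
    (actOn n A : Op p) = tensorOp (Pi.mulSingle n A) := by
  ext f g
  simp only [actOn, tensorOp, of_apply]
  rw [← Finset.mul_prod_erase _ _ (Finset.mem_univ n), Pi.mulSingle_eq_same]
  split_ifs with h
  · rw [Finset.prod_eq_one, mul_one]
    intro j hj
    have hj := Finset.ne_of_mem_erase hj
    simp [Pi.mulSingle_eq_of_ne hj, h j hj]
  · push Not at h
    obtain ⟨j, hj, hfg⟩ := h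
    rw [Finset.prod_eq_zero (Finset.mem_erase.2 ⟨hj, Finset.mem_univ j⟩), mul_zero]
    simp [Pi.mulSingle_eq_of_ne hj, hfg]

/-- `actOn n` as an algebra homomorphism. -/
def actHom (n : Fin N) : Matrix (Fin (p n + 1)) (Fin (p n + 1)) ℂ →ₐ[ℂ] Op p :=
  AlgHom.ofLinearMap
    { toFun := fun A => actOn n A
      map_add' := fun A B => by
        ext f g
        simp only [actOn, of_apply, Matrix.add_apply]
        split_ifs <;> simp
      map_smul' := fun c A => by
        ext f g
        simp only [actOn, of_apply, Matrix.smul_apply]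
        split_ifs <;> simp }
    (by
      change (actOn n (1 : Matrix (Fin (p n + 1)) (Fin (p n + 1)) ℂ) : Op p) = 1
      rw [actOn_eq_tensorOp, Pi.mulSingle_one, tensorOp_one])
    (fun A B => by
      change (actOn n (A * B) : Op p) = (actOn n A : Op p) * (actOn n B : Op p)
      rw [actOn_eq_tensorOp, actOn_eq_tensorOp, actOn_eq_tensorOp, Pi.mulSingle_mul,
        tensorOp_mul])

lemma actHom_apply (n : Fin N) (A : Matrix (Fin (p n + 1)) (Fin (p n + 1)) ℂ) :
    (actHom n A : Op p) = actOn n A := rfl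

lemma actOn_commute {i j : Fin N} (hij : i ≠ j) (A : Matrix (Fin (p i + 1)) (Fin (p i + 1)) ℂ)
    (B : Matrix (Fin (p j + 1)) (Fin (p j + 1)) ℂ) :
    Commute (actOn i A : Op p) (actOn j B) := by
  rw [actOn_eq_tensorOp, actOn_eq_tensorOp]
  have h := Pi.mulSingle_commute (f := fun n => Matrix (Fin (p n + 1)) (Fin (p n + 1)) ℂ) hij A B
  rw [Commute, SemiconjBy, ← tensorOp_mul, ← tensorOp_mul, h.eq]

lemma prod_actOn (A : ∀ n, Matrix (Fin (p n + 1)) (Fin (p n + 1)) ℂ) :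
    (List.ofFn fun n => (actOn n (A n) : Op p)).prod = tensorOp A := by
  have h : (List.ofFn fun n => (actOn n (A n) : Op p)) =
      (List.ofFn fun n => Pi.mulSingle n (A n)).map tensorHom := by
    rw [List.map_ofFn]
    congr 1
    funext n
    exact actOn_eq_tensorOp n (A n)
  rw [h, List.prod_hom]
  change tensorOp _ = _
  congr 1
  funext n
  rw [Pi.list_prod_apply, List.map_ofFn, List.prod_ofFn_eq_single n]
  · simp
  · intro i hi
    simp [Pi.mulSingle_eq_of_ne hi.symm]

end Tensor

/-- The entries of `∏_i (A_i)_i`. -/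
lemma prod_actOn_apply {R : Type} [Ring R] {a : ℕ} (A : Fin a → Matrix (Fin 2) (Fin 2) R)
    (α β : Fin a → Fin 2) :
    (List.ofFn fun i : Fin a => actOn (X := fun _ => Fin 2) i (A i)).prod α β =
      (List.ofFn fun i => A i (α i) (β i)).prod := by
  -- Induction needs partial products: on the sites outside the list, the two configurations must
  -- agree.
  have key : ∀ l : List (Fin a), l.Nodup → ∀ α β : Fin a → Fin 2,
      (l.map fun i : Fin a => actOn (X := fun _ => Fin 2) i (A i)).prod α β =
        if ∀ j, j ∉ l → α j = β j then (l.map fun i => A i (α i) (β i)).prod else 0 := by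
    intro l
    induction l with
    | nil =>
      intro _ α β
      simp [Matrix.one_apply, funext_iff]
    | cons i l ih =>
      intro hl α β
      have hil : i ∉ l := (List.nodup_cons.1 hl).1
      rw [List.map_cons, List.prod_cons, Matrix.mul_apply,
        Finset.sum_eq_single (Function.update α i (β i))]
      · have h1 : actOn (X := fun _ => Fin 2) i (A i) α (Function.update α i (β i)) =
            A i (α i) (β i) := by
          simp only [actOn, of_apply, Function.update_self]
          rw [if_pos]
          intro j hj
          rw [Function.update_of_ne hj]
        have h2 : (∀ j, j ∉ l → Function.update α i (β i) j = β j) ↔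
            ∀ j, j ∉ i :: l → α j = β j := by
          constructor
          · intro h j hj
            rw [List.mem_cons, not_or] at hj
            have := h j hj.2
            rwa [Function.update_of_ne hj.1] at this
          · intro h j hj
            by_cases hji : j = i
            · subst hji; simp
            · rw [Function.update_of_ne hji]
              exact h j (by simp [hji, hj])
        have h3 : (l.map fun k => A k (Function.update α i (β i) k) (β k)) =
            l.map fun k => A k (α k) (β k) := by
          apply List.map_congr_left
          intro k hk
          rw [Function.update_of_ne (ne_of_mem_of_not_mem hk hil)]
        rw [h1, ih (List.nodup_cons.1 hl).2, h3]
        simp only [h2]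
        split_ifs <;> simp
      · intro γ _ hγ
        rw [ih (List.nodup_cons.1 hl).2]
        simp only [actOn, of_apply]
        split_ifs with h1 h2
        · exfalso
          apply hγ
          funext j
          by_cases hji : j = i
          · subst hji; rw [Function.update_self]; exact h2 _ hil
          · rw [Function.update_of_ne hji]; exact (h1 j hji).symm
        all_goals simp
      · simp
  rw [List.ofFn_eq_map, key _ (List.nodup_finRange a), List.ofFn_eq_map]
  simp

/-! ### Polynomial maps -/

/-- `F` is a polynomial map with values in `V`. -/
def IsPoly {σ V : Type} [AddCommGroup V] [Module ℂ V] (F : (σ → ℂ) → V) : Prop :=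
  ∃ (k : ℕ) (P : Fin k → MvPolynomial σ ℂ) (v : Fin k → V),
    ∀ x, F x = ∑ i, MvPolynomial.eval x (P i) • v i

namespace IsPoly

variable {σ V W R : Type} [AddCommGroup V] [Module ℂ V] [AddCommGroup W] [Module ℂ W]
  [Ring R] [Algebra ℂ R]

lemma of_fintype {ι : Type} [Fintype ι] {F : (σ → ℂ) → V} (P : ι → MvPolynomial σ ℂ) (v : ι → V)
    (h : ∀ x, F x = ∑ i, MvPolynomial.eval x (P i) • v i) : IsPoly F :=
  ⟨Fintype.card ι, P ∘ (Fintype.equivFin ι).symm, v ∘ (Fintype.equivFin ι).symm, fun x => by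
    rw [h]
    exact (Equiv.sum_comp (Fintype.equivFin ι).symm
      fun i => MvPolynomial.eval x (P i) • v i).symm⟩

lemma eval_smul (P : MvPolynomial σ ℂ) (v : V) :
    IsPoly fun x : σ → ℂ => MvPolynomial.eval x P • v :=
  ⟨1, fun _ => P, fun _ => v, fun x => by simp⟩

lemma const (v : V) : IsPoly fun _ : σ → ℂ => v := by
  simpa using eval_smul (σ := σ) 1 v

lemma coord (i : σ) : IsPoly fun x : σ → ℂ => x i := by
  simpa using eval_smul (σ := σ) (MvPolynomial.X i) (1 : ℂ)

lemma add {F G : (σ → ℂ) → V} (hF : IsPoly F) (hG : IsPoly G) : IsPoly fun x => F x + G x := by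
  obtain ⟨k, P, v, h⟩ := hF
  obtain ⟨l, Q, w, h'⟩ := hG
  exact of_fintype (Sum.elim P Q) (Sum.elim v w) fun x => by
    rw [h, h', Fintype.sum_sum_type]; rfl

lemma map {F : (σ → ℂ) → V} (hF : IsPoly F) (f : V →ₗ[ℂ] W) : IsPoly fun x => f (F x) := by
  obtain ⟨k, P, v, h⟩ := hF
  exact ⟨k, P, fun i => f (v i), fun x => by simp [h]⟩

lemma sum {ι : Type} (s : Finset ι) {F : ι → (σ → ℂ) → V} (hF : ∀ i ∈ s, IsPoly (F i)) :
    IsPoly fun x => ∑ i ∈ s, F i x := by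
  classical
  induction s using Finset.induction_on with
  | empty => simpa using const (σ := σ) (0 : V)
  | insert a s ha ih =>
    simp only [Finset.sum_insert ha]
    exact (hF a (by simp)).add (ih fun i hi => hF i (by simp [hi]))

lemma smul {f : (σ → ℂ) → ℂ} {G : (σ → ℂ) → V} (hf : IsPoly f) (hG : IsPoly G) :
    IsPoly fun x => f x • G x := by
  obtain ⟨k, P, v, h⟩ := hf
  obtain ⟨l, Q, w, h'⟩ := hG
  refine of_fintype (fun i : Fin k × Fin l => P i.1 * Q i.2) (fun i => v i.1 • w i.2) fun x => ?_
  rw [h, h', Finset.sum_smul_sum, Fintype.sum_prod_type]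
  refine Finset.sum_congr rfl fun i _ => Finset.sum_congr rfl fun j _ => ?_
  rw [map_mul, smul_smul, smul_smul, smul_eq_mul]
  ring_nf

lemma mul {F G : (σ → ℂ) → R} (hF : IsPoly F) (hG : IsPoly G) : IsPoly fun x => F x * G x := by
  obtain ⟨k, P, v, h⟩ := hF
  obtain ⟨l, Q, w, h'⟩ := hG
  refine of_fintype (fun i : Fin k × Fin l => P i.1 * Q i.2) (fun i => v i.1 * w i.2) fun x => ?_
  rw [h, h', Finset.sum_mul_sum, Fintype.sum_prod_type]
  refine Finset.sum_congr rfl fun i _ => Finset.sum_congr rfl fun j _ => ?_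
  rw [map_mul, smul_mul_smul_comm]

lemma pow {F : (σ → ℂ) → R} (hF : IsPoly F) (n : ℕ) : IsPoly fun x => F x ^ n := by
  induction n with
  | zero => simpa using const (1 : R)
  | succ n ih => simpa only [pow_succ] using ih.mul hF

lemma list_prod_map {ι : Type} (l : List ι) {F : ι → (σ → ℂ) → R} (hF : ∀ i, IsPoly (F i)) :
    IsPoly fun x => (l.map fun i => F i x).prod := by
  induction l with
  | nil => simpa using const (1 : R)
  | cons a l ih => simpa only [List.map_cons, List.prod_cons] using (hF a).mul ih

lemma prod_ofFn {n : ℕ} {F : Fin n → (σ → ℂ) → R} (hF : ∀ i, IsPoly (F i)) :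
    IsPoly fun x => (List.ofFn fun i => F i x).prod := by
  simpa only [List.ofFn_eq_map] using list_prod_map (List.finRange n) hF

lemma prod_reverse_ofFn {n : ℕ} {F : Fin n → (σ → ℂ) → R} (hF : ∀ i, IsPoly (F i)) :
    IsPoly fun x => (List.ofFn fun i => F i x).reverse.prod := by
  simpa only [List.ofFn_eq_map, ← List.map_reverse] using list_prod_map (List.finRange n).reverse hF

lemma entry {ι κ : Type} {F : (σ → ℂ) → Matrix ι κ V} (hF : IsPoly F) (i : ι) (j : κ) :
    IsPoly fun x => F x i j :=
  hF.map ({ toFun := fun A => A i j, map_add' := fun _ _ => rfl, map_smul' := fun _ _ => rfl } :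
    Matrix ι κ V →ₗ[ℂ] V)

lemma trace {ι : Type} [Fintype ι] {F : (σ → ℂ) → Matrix ι ι V} (hF : IsPoly F) :
    IsPoly fun x => (F x).trace :=
  hF.map (Matrix.traceLinearMap ι ℂ V)

lemma exists_eval {f : (σ → ℂ) → ℂ} (hf : IsPoly f) :
    ∃ P : MvPolynomial σ ℂ, ∀ x, MvPolynomial.eval x P = f x := by
  obtain ⟨k, P, v, h⟩ := hf
  exact ⟨∑ i, P i * MvPolynomial.C (v i), fun x => by simp [h]⟩

lemma det {ι : Type} [Fintype ι] [DecidableEq ι] {F : (σ → ℂ) → Matrix ι ι ℂ}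
    (hF : ∀ i j, IsPoly fun x => F x i j) : IsPoly fun x => (F x).det := by
  simp only [Matrix.det_apply]
  refine sum _ fun g _ => ?_
  have h : IsPoly fun x => ∏ i, F x (g i) i := by
    simpa only [← List.prod_ofFn, ← Finset.prod_map_toList] using
      list_prod_map Finset.univ.toList (F := fun i x => F x (g i) i) fun i => hF _ _
  exact h.map ((Equiv.Perm.sign g : ℤ) • (LinearMap.id : ℂ →ₗ[ℂ] ℂ))

/-- A polynomial in one variable which does not vanish at zero does not vanish at some nonzero
point. -/
lemma exists_ne_zero {f : (Unit → ℂ) → ℂ} (hf : IsPoly f) (h0 : f 0 ≠ 0) :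
    ∃ s : ℂ, s ≠ 0 ∧ f (fun _ => s) ≠ 0 := by
  obtain ⟨P, hP⟩ := hf.exists_eval
  have hc : Continuous fun s : ℂ => f fun _ => s := by
    simp only [← hP]
    exact (MvPolynomial.continuous_eval P).comp (continuous_pi fun _ => continuous_id)
  have h1 : ∀ᶠ s in nhds (0 : ℂ), f (fun _ => s) ≠ 0 := hc.continuousAt.eventually_ne h0
  obtain ⟨s, hs, hs'⟩ := ((h1.filter_mono nhdsWithin_le_nhds).and
    (self_mem_nhdsWithin : {(0 : ℂ)}ᶜ ∈ nhdsWithin 0 {(0 : ℂ)}ᶜ)).exists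
  exact ⟨s, hs', hs⟩

end IsPoly

lemma isCovectorBasis_iff {ι : Type} [Fintype ι] [DecidableEq ι] (v : ι → ι → ℂ) :
    IsCovectorBasis v ↔ (Matrix.of v).det ≠ 0 := by
  rw [← isUnit_iff_ne_zero, ← Matrix.isUnit_iff_isUnit_det, ← linearIndependent_rows_iff_isUnit]
  constructor
  · exact fun h => h.1
  · intro h
    refine ⟨h, ?_⟩
    exact LinearIndependent.span_eq_top_of_card_eq_finrank' h (by simp)

/-! ### Configurations of spins one half -/

/-- The number of lower components of a basis tensor of `(ℂ²)^{⊗ a}`. -/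
def height {a : ℕ} (f : Fin a → Fin 2) : ℕ := ∑ i, (f i : ℕ)

lemma height_le {a : ℕ} (f : Fin a → Fin 2) : height f ≤ a := by
  have h : height f ≤ ∑ _i : Fin a, 1 := Finset.sum_le_sum fun i _ => by omega
  simpa using h

lemma height_comp {a : ℕ} (f : Fin a → Fin 2) (π : Equiv.Perm (Fin a)) :
    height (f ∘ π) = height f :=
  Equiv.sum_comp π fun i => (f i : ℕ)

lemma prod_comp_eq_pow_height {R : Type*} [CommMonoid R] {a : ℕ} (u : Fin 2 → R)
    (f : Fin a → Fin 2) : ∏ i, u (f i) = u 0 ^ (a - height f) * u 1 ^ height f := by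
  induction a with
  | zero => simp [height]
  | succ a ih =>
    rw [Fin.prod_univ_succ, ih]
    have h1 : height f = (f 0 : ℕ) + height (fun i => f i.succ) := Fin.sum_univ_succ _
    have h2 := height_le fun i => f i.succ
    rw [h1]
    generalize height (fun i => f i.succ) = k at *
    obtain h | h : f 0 = 0 ∨ f 0 = 1 := by omega
    · rw [h]
      have : a + 1 - (((0 : Fin 2) : ℕ) + k) = a - k + 1 := by simp; omega
      rw [this, pow_succ']
      simp [mul_assoc]
    · rw [h]
      have : a + 1 - (((1 : Fin 2) : ℕ) + k) = a - k := by simp; omega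
      rw [this]
      have h3 : (((1 : Fin 2) : ℕ) + k) = k + 1 := by simp [add_comm]
      rw [h3, pow_succ']
      exact mul_left_comm _ _ _

/-- Both sides are coefficients of `(1 + X) ^ a`, expanded over configurations. -/
lemma card_height_eq (a j : ℕ) :
    (Finset.univ.filter fun f : Fin a → Fin 2 => height f = j).card = a.choose j := by
  have h : ∑ f : Fin a → Fin 2, (X : ℕ[X]) ^ height f = (1 + X) ^ a := by
    have h2 : ((1 : ℕ[X]) + X) ^ a = ∏ _i : Fin a, ∑ b : Fin 2, (![1, X] : Fin 2 → ℕ[X]) b := by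
      simp
    rw [h2, Finset.prod_univ_sum, Fintype.piFinset_univ]
    refine Finset.sum_congr rfl fun f _ => ?_
    rw [prod_comp_eq_pow_height]
    simp
  have h3 := congrArg (fun q => Polynomial.coeff q j) h
  simp only [Polynomial.finsetSum_coeff, Polynomial.coeff_X_pow, Polynomial.coeff_one_add_X_pow,
    Nat.cast_id] at h3
  rw [← h3, Finset.card_filter]
  simp only [eq_comm]

lemma exists_height_eq {a j : ℕ} (h : j ≤ a) : ∃ f : Fin a → Fin 2, height f = j := by
  have h1 := Nat.choose_pos h
  rw [← card_height_eq] at h1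
  obtain ⟨f, hf⟩ := Finset.card_pos.1 h1
  exact ⟨f, (Finset.mem_filter.1 hf).2⟩

/-- The height fixes the sizes of the fibres over `0` and `1`, and bijections between fibres glue to
a permutation. -/
lemma exists_perm_of_height_eq {a : ℕ} {f g : Fin a → Fin 2} (h : height f = height g) :
    ∃ π : Equiv.Perm (Fin a), f = g ∘ π := by
  have h1 : ∀ f : Fin a → Fin 2, Fintype.card {i // f i = 1} = height f := by
    intro f
    rw [Fintype.card_subtype, Finset.card_filter]
    refine Finset.sum_congr rfl fun i _ => ?_
    split_ifs with h
    · simp [h]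
    · have : f i = 0 := by omega
      simp [this]
  have h0 : ∀ f : Fin a → Fin 2, Fintype.card {i // f i = 0} = a - height f := by
    intro f
    have : ∀ i, f i = 0 ↔ ¬ f i = 1 := fun i => by omega
    simp only [this]
    rw [Fintype.card_subtype_compl, h1, Fintype.card_fin]
  have e : ∀ c, Nonempty ({i // f i = c} ≃ {i // g i = c}) := by
    intro c
    rw [← Fintype.card_eq]
    obtain hc | hc : c = 0 ∨ c = 1 := by omega
    · rw [hc, h0, h0, h]
    · rw [hc, h1, h1, h]
  exact ⟨Equiv.ofFiberEquiv fun c => (e c).some, by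
    funext i
    exact (Equiv.ofFiberEquiv_map (fun c => (e c).some) i).symm⟩

lemma eq_of_height_eq {a : ℕ} {V : Type*} {F : (Fin a → Fin 2) → V}
    (hF : ∀ f (π : Equiv.Perm (Fin a)), F (f ∘ π) = F f) {f g : Fin a → Fin 2}
    (h : height f = height g) : F f = F g := by
  obtain ⟨π, rfl⟩ := exists_perm_of_height_eq h
  exact hF g π

/-! ### The symmetric projector -/

lemma symProj_apply {a : ℕ} (f g : Fin a → Fin 2) :
    symProj a f g =
      (a.factorial : ℂ)⁻¹ * ∑ π : Equiv.Perm (Fin a), if f = g ∘ π then 1 else 0 := by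
  simp [symProj, permOp, Matrix.sum_apply]

lemma symProj_comp_right {a : ℕ} (f g : Fin a → Fin 2) (τ : Equiv.Perm (Fin a)) :
    symProj a f (g ∘ τ) = symProj a f g := by
  rw [symProj_apply, symProj_apply]
  congr 1
  exact Equiv.sum_comp (Equiv.mulLeft τ) fun π => if f = g ∘ (π : Equiv.Perm (Fin a)) then (1 : ℂ) else 0

lemma sum_symProj_smul {a : ℕ} {V : Type*} [AddCommGroup V] [Module ℂ V]
    {F : (Fin a → Fin 2) → V} (hF : ∀ f (π : Equiv.Perm (Fin a)), F (f ∘ π) = F f)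
    (g : Fin a → Fin 2) : ∑ f, symProj a f g • F f = F g := by
  simp only [symProj_apply, mul_smul, Finset.sum_smul, ite_smul, one_smul, zero_smul]
  rw [← Finset.smul_sum, Finset.sum_comm]
  simp only [Finset.sum_ite_eq', Finset.mem_univ, if_true, hF, Finset.sum_const,
    Finset.card_univ, Fintype.card_perm, Fintype.card_fin]
  rw [← Nat.cast_smul_eq_nsmul ℂ, smul_smul, inv_mul_cancel₀, one_smul]
  exact_mod_cast a.factorial_ne_zero

lemma symProj_transpose (a : ℕ) : (symProj a)ᵀ = symProj a := by
  ext f g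
  rw [transpose_apply, symProj_apply, symProj_apply]
  congr 1
  refine (Equiv.sum_comp (Equiv.inv _) _).symm.trans ?_
  refine Finset.sum_congr rfl fun π _ => ?_
  have : (g = f ∘ ((Equiv.inv (Equiv.Perm (Fin a))) π : Equiv.Perm (Fin a))) ↔ (f = g ∘ π) := by
    constructor
    · rintro rfl; funext i; simp
    · rintro rfl; funext i; simp
  simp only [this]

lemma symIso_comp {a : ℕ} (f : Fin a → Fin 2) (π : Equiv.Perm (Fin a)) (j : Fin (a + 1)) :
    symIso a (f ∘ π) j = symIso a f j := by
  have h : (∑ i, ((f ∘ π) i : ℕ)) = ∑ i, (f i : ℕ) := height_comp f π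
  simp only [symIso, of_apply, h]

lemma transpose_symIso_mul_symProj (a : ℕ) : (symIso a)ᵀ * symProj a = (symIso a)ᵀ := by
  ext j g
  rw [Matrix.mul_apply, transpose_apply,
    ← sum_symProj_smul (F := fun f => symIso a f j) (fun f π => symIso_comp f π j) g]
  simp only [transpose_apply, smul_eq_mul, mul_comm]

lemma symProj_mul_symIso (a : ℕ) : symProj a * symIso a = symIso a := by
  have h := congrArg Matrix.transpose (transpose_symIso_mul_symProj a)
  rwa [transpose_mul, symProj_transpose, transpose_transpose] at h

lemma tensorPow_apply {a : ℕ} (K : Matrix (Fin 2) (Fin 2) ℂ) (f g : Fin a → Fin 2) :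
    (List.ofFn fun i : Fin a => actOn (X := fun _ => Fin 2) i K).prod f g =
      ∏ i, K (f i) (g i) := by
  rw [prod_actOn_apply, List.prod_ofFn]

/-- The columns of `symIso` are symmetric, so both projectors are absorbed. -/
lemma fusedTwist_eq (K : Matrix (Fin 2) (Fin 2) ℂ) (a : ℕ) :
    fusedTwist K a = (symIso a)ᵀ *
      (List.ofFn fun i : Fin a => actOn (X := fun _ => Fin 2) i K).prod * symIso a := by
  rw [fusedTwist, ← Matrix.mul_assoc, ← Matrix.mul_assoc, transpose_symIso_mul_symProj,
    Matrix.mul_assoc _ (symProj a), symProj_mul_symIso]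

/-! ### Binary forms -/

/-- The monomial `x^{m-j} y^j`. -/
def binMonomial (m j : ℕ) : MvPolynomial (Fin 2) ℂ :=
  MvPolynomial.X 0 ^ (m - j) * MvPolynomial.X 1 ^ j

/-- The normalised monomial `√(m choose j) x^{m-j} y^j`. -/
def binWeight (m j : ℕ) : MvPolynomial (Fin 2) ℂ :=
  ((Real.sqrt (m.choose j : ℕ) : ℝ) : ℂ) • binMonomial m j

/-- The realization of `ℂ^{m+1}` by binary forms of degree `m`. -/
def toForm (m : ℕ) : (Fin (m + 1) → ℂ) →ₗ[ℂ] MvPolynomial (Fin 2) ℂ :=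
  Fintype.linearCombination ℂ fun j : Fin (m + 1) => binWeight m j

lemma toForm_apply (m : ℕ) (v : Fin (m + 1) → ℂ) :
    toForm m v = ∑ j : Fin (m + 1), v j • binWeight m j := rfl

lemma prod_X_comp {a : ℕ} (f : Fin a → Fin 2) :
    ∏ i, (MvPolynomial.X (f i) : MvPolynomial (Fin 2) ℂ) = binMonomial a (height f) :=
  prod_comp_eq_pow_height _ f

lemma binMonomial_eq_monomial (m j : ℕ) : binMonomial m j =
    MvPolynomial.monomial (Finsupp.single 0 (m - j) + Finsupp.single 1 j) 1 := by
  rw [binMonomial, MvPolynomial.X_pow_eq_monomial, MvPolynomial.X_pow_eq_monomial,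
    MvPolynomial.monomial_mul, one_mul]

lemma sqrt_choose_ne_zero {m : ℕ} (j : Fin (m + 1)) :
    ((Real.sqrt (m.choose j : ℕ) : ℝ) : ℂ) ≠ 0 := by
  have : 0 < m.choose j := Nat.choose_pos (Nat.lt_succ_iff.1 j.2)
  simp only [ne_eq, Complex.ofReal_eq_zero]
  positivity

lemma toForm_injective (m : ℕ) : Function.Injective (toForm m) := by
  refine linearIndependent_iff_injective_fintypeLinearCombination.1 ?_
  have h := (MvPolynomial.basisMonomials (Fin 2) ℂ).linearIndependent.comp
    (fun j : Fin (m + 1) => (Finsupp.single 0 (m - j) + Finsupp.single 1 (j : ℕ) : Fin 2 →₀ ℕ))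
    (fun i j hij => by
      have := DFunLike.congr_fun hij 1
      simpa [Fin.ext_iff] using this)
  have e : (fun j : Fin (m + 1) => binWeight m j) =
      (fun j : Fin (m + 1) => Units.mk0 _ (sqrt_choose_ne_zero j)) •
        (⇑(MvPolynomial.basisMonomials (Fin 2) ℂ) ∘ fun j : Fin (m + 1) =>
          (Finsupp.single 0 (m - j) + Finsupp.single 1 (j : ℕ) : Fin 2 →₀ ℕ)) := by
    funext j
    simp [binWeight, binMonomial_eq_monomial, Units.smul_def]
  rw [e]
  exact h.units_smul _

lemma mem_range_toForm {m : ℕ} {f : MvPolynomial (Fin 2) ℂ} (hf : f.IsHomogeneous m) :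
    f ∈ LinearMap.range (toForm m) := by
  rw [f.as_sum]
  refine Submodule.sum_mem _ fun d hd => ?_
  have hdeg : d 0 + d 1 = m := by
    have := hf (MvPolynomial.mem_support_iff.1 hd)
    rw [Finsupp.weight_apply, Finsupp.sum_fintype _ _ (by simp)] at this
    simpa using this
  have hd' : d = Finsupp.single 0 (m - d 1) + Finsupp.single 1 (d 1) := by
    ext i
    fin_cases i
    · simp; omega
    · simp
  have hlt : d 1 < m + 1 := by omega
  refine ⟨Pi.single ⟨d 1, hlt⟩ (((Real.sqrt (m.choose (d 1) : ℕ) : ℝ) : ℂ)⁻¹ * f.coeff d), ?_⟩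
  rw [toForm, Fintype.linearCombination_apply_single, binWeight, smul_smul]
  have := sqrt_choose_ne_zero (⟨d 1, hlt⟩ : Fin (m + 1))
  simp only at this ⊢
  rw [mul_right_comm, inv_mul_cancel₀ this, one_mul, binMonomial_eq_monomial, ← hd',
    MvPolynomial.smul_monomial, smul_eq_mul, mul_one]

/-! ### The action of `gl₂` on spins and on binary forms -/

/-- The generators of `gl₂` on `ℂ^{m+1}`. -/
def spinGen (m : ℕ) : Matrix (Fin 2) (Fin 2) (Matrix (Fin (m + 1)) (Fin (m + 1)) ℂ) :=
  !![((m : ℂ) / 2) • 1 + spinZ m, spinMinus m; spinPlus m, ((m : ℂ) / 2) • 1 - spinZ m]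

/-- The operators `x_β ∂_α`. -/
def formGen (α β : Fin 2) : Module.End ℂ (MvPolynomial (Fin 2) ℂ) :=
  LinearMap.mulLeft ℂ (MvPolynomial.X β) * (MvPolynomial.pderiv α).toLinearMap

lemma formGen_apply (α β : Fin 2) (f : MvPolynomial (Fin 2) ℂ) :
    formGen α β f = MvPolynomial.X β * MvPolynomial.pderiv α f := rfl

/-- The normalisation by square roots of binomials turns the square roots in the ladder operators
into the integers produced by differentiation; the next lemma treats the opposite direction. -/
lemma sqrt_mul_sqrt_choose_succ {m j : ℕ} (h : j < m) :
    Real.sqrt ((j + 1 : ℕ) * ((m : ℝ) + 1 - (j + 1 : ℕ))) * Real.sqrt (m.choose (j + 1) : ℕ) =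
      Real.sqrt (m.choose j : ℕ) * ((m : ℝ) - j) := by
  have h1 : ((m.choose (j + 1) : ℕ) : ℝ) * (j + 1) = (m.choose j : ℕ) * ((m : ℝ) - j) := by
    rw [← Nat.cast_sub h.le]
    exact_mod_cast Nat.choose_succ_right_eq m j
  have h2 : (0 : ℝ) ≤ (m : ℝ) - j := sub_nonneg.2 (by exact_mod_cast h.le)
  have h3 : (m : ℝ) + 1 - (j + 1 : ℕ) = (m : ℝ) - j := by push_cast; ring
  rw [h3, ← Real.sqrt_mul (by positivity)]
  have h4 : ((j + 1 : ℕ) * ((m : ℝ) - j)) * (m.choose (j + 1) : ℕ) =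
      (m.choose j : ℕ) * ((m : ℝ) - j) ^ 2 := by
    push_cast
    linear_combination ((m : ℝ) - j) * h1
  rw [h4, Real.sqrt_mul (by positivity), Real.sqrt_sq h2]

lemma sqrt_mul_sqrt_choose {m j : ℕ} (h : j < m) :
    Real.sqrt ((j + 1 : ℕ) * ((m : ℝ) + 1 - (j + 1 : ℕ))) * Real.sqrt (m.choose j : ℕ) =
      Real.sqrt (m.choose (j + 1) : ℕ) * ((j : ℝ) + 1) := by
  have h1 : ((m.choose (j + 1) : ℕ) : ℝ) * (j + 1) = (m.choose j : ℕ) * ((m : ℝ) - j) := by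
    rw [← Nat.cast_sub h.le]
    exact_mod_cast Nat.choose_succ_right_eq m j
  have h2 : (0 : ℝ) ≤ (m : ℝ) - j := sub_nonneg.2 (by exact_mod_cast h.le)
  have h3 : (m : ℝ) + 1 - (j + 1 : ℕ) = (m : ℝ) - j := by push_cast; ring
  rw [h3, ← Real.sqrt_mul (by positivity)]
  have h4 : ((j + 1 : ℕ) * ((m : ℝ) - j)) * (m.choose j : ℕ) =
      (m.choose (j + 1) : ℕ) * ((j : ℝ) + 1) ^ 2 := by
    push_cast
    linear_combination -((j : ℝ) + 1) * h1
  rw [h4, Real.sqrt_mul (by positivity), Real.sqrt_sq (by positivity)]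

lemma pderiv_zero_binMonomial (m j : ℕ) : MvPolynomial.pderiv 0 (binMonomial m j) =
    ((m - j : ℕ) : ℂ) • (MvPolynomial.X 0 ^ (m - j - 1) * MvPolynomial.X 1 ^ j) := by
  have h : MvPolynomial.pderiv (0 : Fin 2) (MvPolynomial.X 1 : MvPolynomial (Fin 2) ℂ) = 0 :=
    MvPolynomial.pderiv_X_of_ne (by decide)
  rw [binMonomial, MvPolynomial.pderiv_mul, MvPolynomial.pderiv_pow, MvPolynomial.pderiv_pow, h,
    MvPolynomial.pderiv_X_self, MvPolynomial.smul_eq_C_mul]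
  simp
  ring

lemma pderiv_one_binMonomial (m j : ℕ) : MvPolynomial.pderiv 1 (binMonomial m j) =
    (j : ℂ) • (MvPolynomial.X 0 ^ (m - j) * MvPolynomial.X 1 ^ (j - 1)) := by
  have h : MvPolynomial.pderiv (1 : Fin 2) (MvPolynomial.X 0 : MvPolynomial (Fin 2) ℂ) = 0 :=
    MvPolynomial.pderiv_X_of_ne (by decide)
  rw [binMonomial, MvPolynomial.pderiv_mul, MvPolynomial.pderiv_pow, MvPolynomial.pderiv_pow, h,
    MvPolynomial.pderiv_X_self, MvPolynomial.smul_eq_C_mul]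
  simp
  ring

/-- `A` on `ℂ^{m+1}` corresponds to `O` on binary forms. -/
def Intertwines (m : ℕ) (A : Matrix (Fin (m + 1)) (Fin (m + 1)) ℂ)
    (O : Module.End ℂ (MvPolynomial (Fin 2) ℂ)) : Prop :=
  ∀ v, toForm m (A *ᵥ v) = O (toForm m v)

namespace Intertwines

variable {m : ℕ} {A B : Matrix (Fin (m + 1)) (Fin (m + 1)) ℂ}
  {O O' : Module.End ℂ (MvPolynomial (Fin 2) ℂ)}

lemma of_binWeight
    (h : ∀ j : Fin (m + 1), ∑ i : Fin (m + 1), A i j • binWeight m i = O (binWeight m j)) :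
    Intertwines m A O := by
  intro v
  have : toForm m ∘ₗ A.mulVecLin = O ∘ₗ toForm m := by
    refine LinearMap.pi_ext' fun j => LinearMap.ext_ring ?_
    simp only [LinearMap.comp_apply, LinearMap.single_apply, mulVecLin_apply, mulVec_single_one]
    rw [toForm_apply, toForm, Fintype.linearCombination_apply_single, one_smul, ← h j]
    rfl
  exact LinearMap.congr_fun this v

lemma one : Intertwines m 1 1 := fun v => by simp

lemma mul (hA : Intertwines m A O) (hB : Intertwines m B O') : Intertwines m (A * B) (O * O') :=
  fun v => by rw [← mulVec_mulVec, hA, hB]; rfl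

lemma add (hA : Intertwines m A O) (hB : Intertwines m B O') : Intertwines m (A + B) (O + O') :=
  fun v => by rw [add_mulVec, map_add, hA, hB]; rfl

lemma smul (c : ℂ) (hA : Intertwines m A O) : Intertwines m (c • A) (c • O) :=
  fun v => by rw [smul_mulVec, map_smul, hA]; rfl

lemma sub (hA : Intertwines m A O) (hB : Intertwines m B O') : Intertwines m (A - B) (O - O') :=
  fun v => by rw [sub_mulVec, map_sub, hA, hB]; rfl

lemma sum {ι : Type*} (s : Finset ι) {A : ι → Matrix (Fin (m + 1)) (Fin (m + 1)) ℂ}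
    {O : ι → Module.End ℂ (MvPolynomial (Fin 2) ℂ)} (h : ∀ i, Intertwines m (A i) (O i)) :
    Intertwines m (∑ i ∈ s, A i) (∑ i ∈ s, O i) := fun v => by
  rw [sum_mulVec, map_sum, LinearMap.sum_apply]
  exact Finset.sum_congr rfl fun i _ => h i v

lemma prod_ofFn {n : ℕ} {A : Fin n → Matrix (Fin (m + 1)) (Fin (m + 1)) ℂ}
    {O : Fin n → Module.End ℂ (MvPolynomial (Fin 2) ℂ)} (h : ∀ i, Intertwines m (A i) (O i)) :
    Intertwines m (List.ofFn A).prod (List.ofFn O).prod := by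
  rw [List.ofFn_eq_map, List.ofFn_eq_map]
  induction List.finRange n with
  | nil => exact one
  | cons i l ih => exact (h i).mul ih

/-- Injectivity of `toForm` transports identities between differential operators to matrices. -/
lemma eq (hA : Intertwines m A O) (hB : Intertwines m B O) : A = B :=
  Matrix.ext_of_mulVec_single fun _ => toForm_injective m ((hA _).trans (hB _).symm)

end Intertwines

/-- The shift by `m / 2` makes the diagonal generators the degrees `m - j` and `j` in the two
variables; off the diagonal, the square root identities above apply. -/
lemma intertwines_spinGen (m : ℕ) (α β : Fin 2) :
    Intertwines m (spinGen m α β) (formGen α β) := by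
  refine Intertwines.of_binWeight fun j => ?_
  rw [formGen_apply]
  have hj : (j : ℕ) ≤ m := Nat.lt_succ_iff.1 j.2
  fin_cases α <;> fin_cases β
  · simp only [spinGen, spinZ, Fin.zero_eta, Fin.isValue, of_apply, cons_val', cons_val_zero,
      cons_val_fin_one]
    rw [Finset.sum_eq_single j (fun i _ hi => by simp [hi]) (by simp)]
    rw [binWeight, Derivation.map_smul, pderiv_zero_binMonomial, Matrix.add_apply, Matrix.smul_apply,
      Matrix.one_apply_eq, diagonal_apply_eq, mul_smul_comm, mul_smul_comm, smul_comm]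
    congr 1
    rcases hj.eq_or_lt with h | h
    · simp [h]; ring_nf; simp
    · rw [binMonomial, ← mul_assoc, ← pow_succ', Nat.sub_add_cancel (by omega),
        Nat.cast_sub hj]
      congr 1
      simp
      ring
  · simp only [spinGen, spinMinus, spinPlus, Fin.zero_eta, Fin.mk_one, Fin.isValue, of_apply,
      cons_val', cons_val_zero, cons_val_one, cons_val_fin_one, transpose_apply, ite_smul,
      zero_smul]
    rw [Fin.sum_univ_eq_sum_range (fun i => if (j : ℕ) + 1 = i then
      ((Real.sqrt ((i : ℝ) * ((m : ℝ) + 1 - (i : ℝ))) : ℝ) : ℂ) • binWeight m i else 0) (m + 1),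
      Finset.sum_ite_eq, binWeight.eq_1 m j, Derivation.map_smul, pderiv_zero_binMonomial, mul_smul_comm,
      mul_smul_comm, smul_smul]
    rcases hj.eq_or_lt with h | h
    · simp [h]
    · rw [if_pos (by simpa using h), binWeight, smul_smul, ← Complex.ofReal_mul,
        sqrt_mul_sqrt_choose_succ h, Nat.cast_sub hj, binMonomial]
      push_cast
      congr 1
      rw [pow_succ, show m - ((j : ℕ) + 1) = m - j - 1 by omega]
      ring
  · simp only [spinGen, spinPlus, Fin.zero_eta, Fin.mk_one, Fin.isValue, of_apply,
      cons_val', cons_val_zero, cons_val_one, cons_val_fin_one, ite_smul,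
      zero_smul]
    obtain ⟨j, hjm⟩ := j
    simp only at hj ⊢
    rw [binWeight, Derivation.map_smul, pderiv_one_binMonomial, mul_smul_comm, mul_smul_comm, smul_smul]
    cases j with
    | zero => simp
    | succ j =>
      simp only [add_left_inj]
      rw [Fin.sum_univ_eq_sum_range (fun i => if i = j then
        ((Real.sqrt (((j + 1 : ℕ) : ℝ) * ((m : ℝ) + 1 - ((j + 1 : ℕ) : ℝ))) : ℝ) : ℂ) •
          binWeight m i else 0) (m + 1), Finset.sum_ite_eq', if_pos (by simp; omega), binWeight,
        smul_smul, ← Complex.ofReal_mul, sqrt_mul_sqrt_choose (by omega), binMonomial]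
      push_cast
      congr 1
      rw [show m - j = m - (j + 1) + 1 by omega, pow_succ]
      ring
  · simp only [spinGen, spinZ, Fin.mk_one, Fin.isValue, of_apply, cons_val', cons_val_one,
      cons_val_fin_one]
    rw [Finset.sum_eq_single j (fun i _ hi => by simp [hi]) (by simp)]
    rw [binWeight, Derivation.map_smul, pderiv_one_binMonomial, Matrix.sub_apply, Matrix.smul_apply,
      Matrix.one_apply_eq, diagonal_apply_eq, mul_smul_comm, mul_smul_comm, smul_comm]
    congr 1
    rcases Nat.eq_zero_or_pos (j : ℕ) with h | h
    · simp [h]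
    · rw [binMonomial, mul_left_comm, ← pow_succ', Nat.sub_add_cancel (by omega)]
      congr 1
      simp

/-! ### A Capelli identity for symmetric tensors -/

lemma List.prod_ofFn_sum {R : Type*} [Semiring R] {n : ℕ} (f : Fin n → Fin 2 → R) :
    (List.ofFn fun i => ∑ a, f i a).prod =
      ∑ γ : Fin n → Fin 2, (List.ofFn fun i => f i (γ i)).prod := by
  induction n with
  | zero => simp
  | succ n ih =>
    rw [List.ofFn_succ, List.prod_cons, ih, Finset.sum_mul_sum, ← Fintype.sum_prod_type']
    refine Fintype.sum_equiv (Fin.consEquiv fun _ => Fin 2) _ _ fun x => ?_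
    rw [List.ofFn_succ, List.prod_cons]
    rfl

/-- The derivative `∑_a u_a ∂_a`. -/
def dirDeriv (u : Fin 2 → ℂ) : Module.End ℂ (MvPolynomial (Fin 2) ℂ) :=
  ∑ a, u a • (MvPolynomial.pderiv a).toLinearMap

/-- Multiplication by a form. -/
def mulForm (f : MvPolynomial (Fin 2) ℂ) : Module.End ℂ (MvPolynomial (Fin 2) ℂ) :=
  LinearMap.mulLeft ℂ f

lemma dirDeriv_apply (u : Fin 2 → ℂ) (f : MvPolynomial (Fin 2) ℂ) :
    dirDeriv u f = u 0 • MvPolynomial.pderiv 0 f + u 1 • MvPolynomial.pderiv 1 f := by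
  simp [dirDeriv, Fin.sum_univ_two]

lemma dirDeriv_mul (u : Fin 2 → ℂ) (f g : MvPolynomial (Fin 2) ℂ) :
    dirDeriv u (f * g) = dirDeriv u f * g + f * dirDeriv u g := by
  simp only [dirDeriv_apply, MvPolynomial.pderiv_mul, MvPolynomial.smul_eq_C_mul]
  ring

lemma dirDeriv_X (u : Fin 2 → ℂ) (b : Fin 2) :
    dirDeriv u (MvPolynomial.X b) = MvPolynomial.C (u b) := by
  rw [dirDeriv_apply]
  fin_cases b <;> simp [MvPolynomial.pderiv_X, MvPolynomial.smul_eq_C_mul]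

lemma mulForm_mul (f g : MvPolynomial (Fin 2) ℂ) : mulForm (f * g) = mulForm f * mulForm g :=
  LinearMap.ext fun h => mul_assoc f g h

/-- Repeated use of the commutator of a directional derivative with a variable, which is the scalar
`u b`. -/
lemma dirDeriv_pow_mul_mulForm_X (u : Fin 2 → ℂ) (b : Fin 2) (r : ℕ) :
    dirDeriv u ^ r * mulForm (MvPolynomial.X b) * dirDeriv u =
      mulForm (MvPolynomial.X b) * dirDeriv u ^ (r + 1) + ((r : ℂ) * u b) • dirDeriv u ^ r := by
  have h : dirDeriv u * mulForm (MvPolynomial.X b) =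
      mulForm (MvPolynomial.X b) * dirDeriv u + u b • 1 := by
    refine LinearMap.ext fun f => ?_
    rw [LinearMap.add_apply, Module.End.mul_apply, Module.End.mul_apply, LinearMap.smul_apply,
      Module.End.one_apply, mulForm, LinearMap.mulLeft_apply, LinearMap.mulLeft_apply,
      dirDeriv_mul, dirDeriv_X, MvPolynomial.smul_eq_C_mul, add_comm]
  induction r with
  | zero => simp
  | succ r ih =>
    rw [pow_succ' (dirDeriv u) r, mul_assoc, mul_assoc, ← mul_assoc (dirDeriv u ^ r), ih, mul_add,
      ← mul_assoc, h, add_mul, mul_smul_comm, ← pow_succ', smul_mul_assoc, one_mul, add_assoc,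
      ← add_smul, mul_assoc, ← pow_succ']
    push_cast
    rw [add_mul, one_mul, add_comm (u b)]

/-- Moving the last variable past the `m` derivatives already collected produces `m * u b` times
their power, which is precisely what the shift of the last factor removes. -/
lemma capelli_dirDeriv (u : Fin 2 → ℂ) {m : ℕ} (β : Fin m → Fin 2) :
    (List.ofFn fun i : Fin m =>
      mulForm (MvPolynomial.X (β i)) * dirDeriv u - (((i : ℕ) : ℂ) * u (β i)) • 1).prod =
      mulForm (∏ i, MvPolynomial.X (β i)) * dirDeriv u ^ m := by
  induction m with
  | zero =>
    refine LinearMap.ext fun f => ?_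
    simp [mulForm]
  | succ m ih =>
    rw [List.ofFn_succ', List.concat_eq_append, List.prod_append, List.prod_singleton]
    simp only [Fin.val_castSucc, Fin.val_last]
    rw [ih fun i => β i.castSucc, Fin.prod_univ_castSucc, mulForm_mul, mul_sub, mul_assoc,
      ← mul_assoc (dirDeriv u ^ m), dirDeriv_pow_mul_mulForm_X, mul_smul_comm, mul_one, mul_add,
      mul_smul_comm, add_sub_cancel_right, mul_assoc]

/-- As many derivatives as the degree evaluate the form at `u`, up to a factorial. The truncated
exponents below are harmless because their coefficients vanish. -/
lemma dirDeriv_pow_monomial (u : Fin 2 → ℂ) (r : ℕ) : ∀ a b : ℕ, a + b = r →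
    (dirDeriv u ^ r) (MvPolynomial.X 0 ^ a * MvPolynomial.X 1 ^ b) =
      MvPolynomial.C ((r.factorial : ℂ) * (u 0 ^ a * u 1 ^ b)) := by
  have hX : ∀ (c : Fin 2) (a : ℕ), dirDeriv u (MvPolynomial.X c ^ a) =
      ((a : ℂ) * u c) • MvPolynomial.X c ^ (a - 1) := by
    intro c a
    induction a with
    | zero => simp [dirDeriv_apply]
    | succ a ih =>
      rw [pow_succ, dirDeriv_mul, ih, dirDeriv_X, MvPolynomial.smul_eq_C_mul,
        MvPolynomial.smul_eq_C_mul]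
      cases a with
      | zero => simp
      | succ a => simp [pow_succ]; ring
  induction r with
  | zero =>
    intro a b h
    obtain ⟨rfl, rfl⟩ : a = 0 ∧ b = 0 := by omega
    simp
  | succ r ih =>
    intro a b h
    have e : dirDeriv u (MvPolynomial.X 0 ^ a * MvPolynomial.X 1 ^ b) =
        ((a : ℂ) * u 0) • (MvPolynomial.X 0 ^ (a - 1) * MvPolynomial.X 1 ^ b) +
        ((b : ℂ) * u 1) • (MvPolynomial.X 0 ^ a * MvPolynomial.X 1 ^ (b - 1)) := by
      rw [dirDeriv_mul, hX, hX, smul_mul_assoc, mul_smul_comm]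
    have h1 : ((a : ℂ) * u 0) • (dirDeriv u ^ r)
        (MvPolynomial.X 0 ^ (a - 1) * MvPolynomial.X 1 ^ b) =
        MvPolynomial.C ((r.factorial : ℂ) * (a * (u 0 ^ a * u 1 ^ b))) := by
      cases a with
      | zero => simp
      | succ a =>
        rw [Nat.add_sub_cancel, ih a b (by omega), MvPolynomial.smul_eq_C_mul, ← map_mul]
        congr 1
        ring
    have h2 : ((b : ℂ) * u 1) • (dirDeriv u ^ r)
        (MvPolynomial.X 0 ^ a * MvPolynomial.X 1 ^ (b - 1)) =
        MvPolynomial.C ((r.factorial : ℂ) * (b * (u 0 ^ a * u 1 ^ b))) := by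
      cases b with
      | zero => simp
      | succ b =>
        rw [Nat.add_sub_cancel, ih a b (by omega), MvPolynomial.smul_eq_C_mul, ← map_mul]
        congr 1
        ring
    rw [pow_succ, Module.End.mul_apply, e, map_add, map_smul, map_smul, h1, h2, ← map_add,
      Nat.factorial_succ, ← h]
    congr 1
    push_cast
    ring

/-- The factors of the Capelli product. -/
def capelliFactor (k : ℕ) (α β : Fin 2) : Module.End ℂ (MvPolynomial (Fin 2) ℂ) :=
  formGen α β - ((k : ℂ) * if α = β then 1 else 0) • 1

/-- A weight that is a product over sites lets the sum over configurations be performed factor by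
factor, keeping the order of the factors. -/
lemma sum_prod_smul_capelli (u : Fin 2 → ℂ) {m : ℕ} (β : Fin m → Fin 2) :
    ∑ γ : Fin m → Fin 2, (∏ i, u (γ i)) •
      (List.ofFn fun i : Fin m => capelliFactor i (γ i) (β i)).prod =
      mulForm (∏ i, MvPolynomial.X (β i)) * dirDeriv u ^ m := by
  rw [← capelli_dirDeriv]
  have h : ∀ i : Fin m, mulForm (MvPolynomial.X (β i)) * dirDeriv u -
      (((i : ℕ) : ℂ) * u (β i)) • 1 = ∑ a, u a • capelliFactor i a (β i) := by
    intro i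
    simp only [capelliFactor, smul_sub, Finset.sum_sub_distrib, dirDeriv, Finset.mul_sum]
    congr 1
    · refine Finset.sum_congr rfl fun a _ => ?_
      rw [mul_smul_comm]
      rfl
    · simp only [smul_smul, ← Finset.sum_smul]
      congr 1
      simp [mul_comm]
  simp only [h, List.prod_ofFn_sum]
  exact Finset.sum_congr rfl fun γ _ => (List.prod_ofFn_smul _ _).symm

/-- For a coefficient depending on the number of lower components only, the Capelli product acts
on binary forms of degree `m` as its normally ordered version. -/
lemma sum_height_smul_capelli (c : ℕ → ℂ) {m j : ℕ} (hj : j ≤ m) (β : Fin m → Fin 2) :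
    (∑ γ : Fin m → Fin 2, c (height γ) •
      (List.ofFn fun i : Fin m => capelliFactor i (γ i) (β i)).prod) (binMonomial m j) =
      ((m.factorial : ℂ) * c j) • ∏ i, MvPolynomial.X (β i) := by
  -- Interpolation at the nodes `0, …, m`: any function of the height is a combination of the
  -- functions `l ^ height γ`, which are product weights for `u = (1, l)`. The convention `0 ^ 0 =
  -- 1` covers the node `0`.
  set V : Matrix (Fin (m + 1)) (Fin (m + 1)) ℂ := vandermonde fun k => ((k : ℕ) : ℂ) with hV
  have hdet : IsUnit V.det := by
    rw [isUnit_iff_ne_zero, hV, det_vandermonde_ne_zero_iff]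
    intro a b hab
    exact Fin.ext (Nat.cast_injective (R := ℂ) hab)
  set w : Fin (m + 1) → ℂ := (fun k : Fin (m + 1) => c k) ᵥ* V⁻¹ with hw
  have hc : ∀ k ≤ m, c k = ∑ l, w l * ((l : ℕ) : ℂ) ^ k := by
    intro k hk
    have h : w ᵥ* V = fun k : Fin (m + 1) => c k := by
      rw [hw, vecMul_vecMul, nonsing_inv_mul _ hdet, vecMul_one]
    have h' := congrFun h ⟨k, Nat.lt_succ_of_le hk⟩
    rw [← show _ = c k from h']
    rfl
  have hu : ∀ (l : Fin (m + 1)) (γ : Fin m → Fin 2),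
      ((l : ℕ) : ℂ) ^ height γ = ∏ i, (![1, ((l : ℕ) : ℂ)] : Fin 2 → ℂ) (γ i) := by
    intro l γ
    rw [prod_comp_eq_pow_height]
    simp
  have e : ∑ γ : Fin m → Fin 2, c (height γ) •
      (List.ofFn fun i : Fin m => capelliFactor i (γ i) (β i)).prod =
      ∑ l, w l • (mulForm (∏ i, MvPolynomial.X (β i)) *
        dirDeriv (![1, ((l : ℕ) : ℂ)] : Fin 2 → ℂ) ^ m) := by
    simp only [hc _ (height_le _), hu, Finset.sum_smul, mul_smul]
    rw [Finset.sum_comm]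
    refine Finset.sum_congr rfl fun l _ => ?_
    rw [← Finset.smul_sum, sum_prod_smul_capelli]
  rw [e, LinearMap.sum_apply, hc j hj, Finset.mul_sum, Finset.sum_smul]
  refine Finset.sum_congr rfl fun l _ => ?_
  rw [LinearMap.smul_apply, Module.End.mul_apply, binMonomial,
    dirDeriv_pow_monomial _ m (m - j) j (by omega)]
  simp only [mulForm, LinearMap.mulLeft_apply, MvPolynomial.smul_eq_C_mul, map_mul]
  simp
  ring

/-! ### The fused twist on binary forms -/

/-- The substitution `x_a ↦ ∑_b K_{ba} x_b`. -/
def substForm (K : Matrix (Fin 2) (Fin 2) ℂ) :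
    MvPolynomial (Fin 2) ℂ →ₐ[ℂ] MvPolynomial (Fin 2) ℂ :=
  MvPolynomial.aeval fun a => ∑ b, K b a • MvPolynomial.X b

lemma substForm_binMonomial_height (K : Matrix (Fin 2) (Fin 2) ℂ) {m : ℕ} (α : Fin m → Fin 2) :
    substForm K (binMonomial m (height α)) =
      ∑ β : Fin m → Fin 2, (∏ i, K (β i) (α i)) • ∏ i, MvPolynomial.X (β i) := by
  rw [← prod_X_comp, map_prod]
  simp only [substForm, MvPolynomial.aeval_X, Finset.prod_univ_sum, Fintype.piFinset_univ,
    Finset.prod_smul]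

/-- Under `symIso` followed by the weighted monomials, a basis tensor becomes the commutative
product of its variables, so a tensor power of `K` becomes a substitution. -/
lemma intertwines_fusedTwist (K : Matrix (Fin 2) (Fin 2) ℂ) (m : ℕ) :
    Intertwines m (fusedTwist K m) (substForm K).toLinearMap := by
  refine Intertwines.of_binWeight fun j => ?_
  have hW : ∀ β : Fin m → Fin 2, ∑ i : Fin (m + 1), symIso m β i • binWeight m i =
      ∏ i, MvPolynomial.X (β i) := by
    intro β
    have hβ : height β < m + 1 := Nat.lt_succ_of_le (height_le β)
    rw [Finset.sum_eq_single ⟨height β, hβ⟩]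
    · simp only [symIso, of_apply]
      rw [if_pos (by rfl), binWeight, smul_smul, Complex.ofReal_inv, inv_mul_cancel₀, one_smul,
        prod_X_comp]
      exact sqrt_choose_ne_zero (⟨height β, hβ⟩ : Fin (m + 1))
    · intro i _ hi
      have : ¬ (∑ k, (β k : ℕ)) = (i : ℕ) := fun h => hi (Fin.ext h.symm)
      simp only [symIso, of_apply, if_neg this, zero_smul]
    · simp
  have h1 : ∑ i : Fin (m + 1), fusedTwist K m i j • binWeight m i =
      ∑ α : Fin m → Fin 2, symIso m α j • substForm K (binMonomial m (height α)) := by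
    simp only [substForm_binMonomial_height, ← hW]
    rw [fusedTwist_eq]
    simp only [Matrix.mul_apply, transpose_apply, tensorPow_apply, Finset.sum_mul,
      Finset.sum_smul, Finset.smul_sum, smul_smul]
    rw [Finset.sum_comm]
    refine Finset.sum_congr rfl fun α _ => ?_
    rw [Finset.sum_comm]
    refine Finset.sum_congr rfl fun β _ => Finset.sum_congr rfl fun i _ => ?_
    congr 1
    ring
  have h2 : ∀ α : Fin m → Fin 2, symIso m α j • substForm K (binMonomial m (height α)) =
      if height α = j then ((((Real.sqrt ((m.choose (j : ℕ) : ℕ) : ℝ))⁻¹ : ℝ) : ℂ)) •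
        substForm K (binMonomial m j) else 0 := by
    intro α
    simp only [symIso, of_apply]
    split_ifs with h h' h'
    · rw [h']
    · exact absurd h h'
    · exact absurd h' h
    · rw [zero_smul]
  -- All `m.choose j` configurations of height `j` contribute equally; divided by the normalising
  -- square root, their number is that square root again.
  rw [h1, Finset.sum_congr rfl fun α _ => h2 α, ← Finset.sum_filter, Finset.sum_const,
    card_height_eq, ← Nat.cast_smul_eq_nsmul ℂ, smul_smul, binWeight, map_smul]
  change _ = _ • substForm K (binMonomial m j)
  congr 1
  rw [Complex.ofReal_inv, ← div_eq_mul_inv, div_eq_iff (sqrt_choose_ne_zero j),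
    ← Complex.ofReal_mul, Real.mul_self_sqrt (by positivity)]
  simp

/-! ### The fused Lax operator at its special point -/

/-- The Lax operator of a single site. -/
def siteLax (m : ℕ) (η μ : ℂ) (α β : Fin 2) : Matrix (Fin (m + 1)) (Fin (m + 1)) ℂ :=
  ((μ + η / 2 - η * m / 2) * if α = β then 1 else 0) • 1 + η • spinGen m α β

/-- The scalar part of `siteLax` compensates the `m / 2` built into `spinGen`. -/
lemma lax_apply {N : ℕ} (p : Fin N → ℕ) (η : ℂ) (n : Fin N) (μ : ℂ) (α β : Fin 2) :
    lax p η n μ α β = actOn n (siteLax (p n) η μ α β) := by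
  fin_cases α <;> fin_cases β
  · simp only [lax, siteLax, spinGen, Fin.zero_eta, Fin.isValue, of_apply, cons_val', cons_val_zero,
      cons_val_fin_one, if_true]
    congr 1
    module
  · simp [lax, siteLax, spinGen]
  · simp [lax, siteLax, spinGen]
  · simp only [lax, siteLax, spinGen, Fin.mk_one, Fin.isValue, of_apply, cons_val', cons_val_one,
      cons_val_fin_one, if_true]
    congr 1
    module

/-- At this argument the scalar part is `-k * η`, the `k`-th Capelli shift. -/
lemma intertwines_siteLax (m : ℕ) (η : ℂ) (k : ℕ) (α β : Fin 2) :
    Intertwines m (siteLax m η ((m / 2 - 1 / 2 - k) * η) α β) (η • capelliFactor k α β) := by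
  have h : η • capelliFactor k α β =
      (((m / 2 - 1 / 2 - k) * η + η / 2 - η * m / 2) * if α = β then 1 else 0) • 1 +
        η • formGen α β := by
    rw [capelliFactor]
    module
  rw [h]
  exact (Intertwines.one.smul _).add ((intertwines_spinGen m α β).smul η)

/-- The matrix `P⁺ P⁺ K_1 ⋯ K_a`. -/
def projTwist (K : Matrix (Fin 2) (Fin 2) ℂ) (a : ℕ) :
    Matrix (Fin a → Fin 2) (Fin a → Fin 2) ℂ :=
  symProj a * (symProj a * (List.ofFn fun i : Fin a => actOn (X := fun _ => Fin 2) i K).prod)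

/-- A tensor power of one matrix commutes with permutations, and the adjacent symmetrizer absorbs
them. -/
lemma projTwist_comp (K : Matrix (Fin 2) (Fin 2) ℂ) {a : ℕ} (f g : Fin a → Fin 2)
    (τ : Equiv.Perm (Fin a)) : projTwist K a f (g ∘ τ) = projTwist K a f g := by
  rw [projTwist, Matrix.mul_apply, Matrix.mul_apply]
  refine Finset.sum_congr rfl fun h _ => ?_
  congr 1
  rw [Matrix.mul_apply, Matrix.mul_apply]
  refine (Equiv.sum_comp (Equiv.arrowCongr τ.symm (Equiv.refl (Fin 2))) _).symm.trans ?_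
  refine Finset.sum_congr rfl fun k _ => ?_
  have e : (Equiv.arrowCongr τ.symm (Equiv.refl (Fin 2))) k = k ∘ τ := by
    funext i; simp [Equiv.arrowCongr]
  rw [e, symProj_comp_right, tensorPow_apply, tensorPow_apply]
  congr 1
  exact Equiv.prod_comp τ fun i => K (k i) (g i)

lemma sum_projTwist_smul (K : Matrix (Fin 2) (Fin 2) ℂ) {a : ℕ} (γ : Fin a → Fin 2) :
    ∑ β : Fin a → Fin 2, projTwist K a β γ • ∏ i, MvPolynomial.X (R := ℂ) (β i) =
      substForm K (binMonomial a (height γ)) := by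
  have hF : ∀ (f : Fin a → Fin 2) (π : Equiv.Perm (Fin a)),
      ∏ i, MvPolynomial.X (R := ℂ) ((f ∘ π) i) = ∏ i, MvPolynomial.X (R := ℂ) (f i) :=
    fun f π => Equiv.prod_comp π fun i => MvPolynomial.X (R := ℂ) (f i)
  have key : ∀ M : Matrix (Fin a → Fin 2) (Fin a → Fin 2) ℂ,
      ∑ β, (symProj a * M) β γ • ∏ i, MvPolynomial.X (R := ℂ) (β i) =
        ∑ β, M β γ • ∏ i, MvPolynomial.X (R := ℂ) (β i) := by
    intro M
    simp only [Matrix.mul_apply, Finset.sum_smul]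
    rw [Finset.sum_comm]
    refine Finset.sum_congr rfl fun β _ => ?_
    rw [← sum_symProj_smul (F := fun f => ∏ i, MvPolynomial.X (R := ℂ) (f i)) hF β,
      Finset.smul_sum]
    refine Finset.sum_congr rfl fun f _ => ?_
    rw [smul_smul, mul_comm]
  rw [projTwist, key, key, substForm_binMonomial_height]
  simp only [tensorPow_apply]

/-- At its special point, the fused Lax operator is proportional to a permutation operator. -/
lemma fused_siteLax (K : Matrix (Fin 2) (Fin 2) ℂ) (m : ℕ) (η : ℂ) :
    ∑ β : Fin m → Fin 2, ∑ γ : Fin m → Fin 2, projTwist K m β γ •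
      (List.ofFn fun i : Fin m =>
        siteLax m η ((m / 2 - 1 / 2 - (i : ℕ)) * η) (γ i) (β i)).prod =
      (η ^ m * m.factorial) • fusedTwist K m := by
  set O : Module.End ℂ (MvPolynomial (Fin 2) ℂ) := ∑ β : Fin m → Fin 2, ∑ γ : Fin m → Fin 2,
    projTwist K m β γ •
      (List.ofFn fun i : Fin m => η • capelliFactor i (γ i) (β i)).prod with hO
  have h1 : Intertwines m (∑ β : Fin m → Fin 2, ∑ γ : Fin m → Fin 2, projTwist K m β γ •
      (List.ofFn fun i : Fin m =>
        siteLax m η ((m / 2 - 1 / 2 - (i : ℕ)) * η) (γ i) (β i)).prod) O :=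
    Intertwines.sum _ fun β => Intertwines.sum _ fun γ => Intertwines.smul _
      (Intertwines.prod_ofFn fun i => intertwines_siteLax m η i (γ i) (β i))
  have hO' : O = η ^ m • ∑ β : Fin m → Fin 2, ∑ γ : Fin m → Fin 2, projTwist K m β γ •
      (List.ofFn fun i : Fin m => capelliFactor i (γ i) (β i)).prod := by
    rw [hO, Finset.smul_sum]
    refine Finset.sum_congr rfl fun β _ => ?_
    rw [Finset.smul_sum]
    refine Finset.sum_congr rfl fun γ _ => ?_
    have e : (List.ofFn fun i : Fin m => η • capelliFactor i (γ i) (β i)).prod =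
        (∏ _i : Fin m, η) • (List.ofFn fun i : Fin m => capelliFactor i (γ i) (β i)).prod :=
      List.prod_ofFn_smul _ _
    rw [e, Finset.prod_const, Finset.card_univ, Fintype.card_fin, smul_comm]
  -- It suffices to compare the operators on degree `m`, since only these forms lie in the image of
  -- `toForm m`.
  have h2 : ∀ j ≤ m, O (binMonomial m j) =
      (η ^ m * m.factorial) • substForm K (binMonomial m j) := by
    intro j hj
    obtain ⟨γ₀, rfl⟩ := exists_height_eq hj
    rw [hO', LinearMap.smul_apply, LinearMap.sum_apply, ← sum_projTwist_smul, mul_smul]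
    congr 1
    rw [Finset.smul_sum]
    refine Finset.sum_congr rfl fun β _ => ?_
    -- Symmetry in the column index makes the coefficient a function of the height; a representative
    -- is chosen for each attained height, and `0` is a dummy value elsewhere.
    have hc : ∃ c : ℕ → ℂ, ∀ γ, projTwist K m β γ = c (height γ) := by
      classical
      refine ⟨fun k => if h : ∃ γ : Fin m → Fin 2, height γ = k then projTwist K m β h.choose
        else 0, fun γ => ?_⟩
      have h : ∃ γ' : Fin m → Fin 2, height γ' = height γ := ⟨γ, rfl⟩
      simp only [dif_pos h]
      exact eq_of_height_eq (fun f π => projTwist_comp K β f π) h.choose_spec.symm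
    obtain ⟨c, hc⟩ := hc
    simp only [hc]
    rw [sum_height_smul_capelli c hj, mul_smul]
  have h3 : Intertwines m (∑ β : Fin m → Fin 2, ∑ γ : Fin m → Fin 2, projTwist K m β γ •
      (List.ofFn fun i : Fin m =>
        siteLax m η ((m / 2 - 1 / 2 - (i : ℕ)) * η) (γ i) (β i)).prod)
      ((η ^ m * m.factorial) • (substForm K).toLinearMap) := by
    intro v
    rw [h1, toForm_apply, map_sum, map_sum]
    refine Finset.sum_congr rfl fun j _ => ?_
    rw [map_smul, map_smul, binWeight, map_smul, map_smul, h2 _ (Nat.lt_succ_iff.1 j.2)]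
    rfl
  exact h3.eq ((intertwines_fusedTwist K m).smul _)

/-! ### Fused transfer matrices: polynomial dependence and leading asymptotics -/

section Chain

variable {N : ℕ} (p : Fin N → ℕ) (η : ℂ) (K : Matrix (Fin 2) (Fin 2) ℂ)

/-- Cyclicity of the trace may fail for operator entries, but scalar matrices can still be moved
around. -/
lemma trace_scalar_mul_mul_scalar {κ : Type} [Fintype κ] [DecidableEq κ] (C D : Matrix κ κ ℂ)
    (X : Matrix κ κ (Op p)) :
    (C.map (fun c => c • (1 : Op p)) * X * D.map (fun c => c • (1 : Op p))).trace =
      ∑ β, ∑ α, (D * C) β α • X α β := by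
  simp only [Matrix.trace, Matrix.diag_apply, Matrix.mul_apply (M := _ * _),
    Matrix.mul_apply (M := Matrix.map _ _), Matrix.mul_apply (M := D), Matrix.map_apply,
    mul_smul_comm, smul_mul_assoc, one_mul, mul_one, Finset.smul_sum, Finset.sum_smul, smul_smul]
  rw [Finset.sum_comm]
  refine Finset.sum_congr rfl fun β _ => ?_
  rw [Finset.sum_comm]

/-- The trace over the auxiliary space of `P⁺ M_1 ⋯ M_a P⁺`. -/
def symTrace {a : ℕ} (M : Fin a → Matrix (Fin 2) (Fin 2) (Op p)) : Op p :=
  ∑ β : Fin a → Fin 2, ∑ α : Fin a → Fin 2,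
    (symProj a * symProj a) β α • (List.ofFn fun i => M i (α i) (β i)).prod

lemma fusedTransfer_eq_symTrace (ξ : Fin N → ℂ) (a : ℕ) (μ : ℂ) :
    fusedTransfer p η K ξ a μ =
      symTrace p fun i : Fin a => monodromy p η K ξ (μ + ((a : ℂ) - 1 - ((i : ℕ) : ℂ)) * η) := by
  rw [fusedTransfer, fusedMonodromy, trace_scalar_mul_mul_scalar, symTrace]
  simp only [prod_actOn_apply]

lemma symTrace_smul {a : ℕ} (c : ℂ) (M : Fin a → Matrix (Fin 2) (Fin 2) (Op p)) :
    symTrace p (fun i => c • M i) = c ^ a • symTrace p M := by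
  simp only [symTrace, Finset.smul_sum, Matrix.smul_apply]
  refine Finset.sum_congr rfl fun β _ => Finset.sum_congr rfl fun α _ => ?_
  rw [List.prod_ofFn_smul, smul_comm]
  simp

lemma lax_add (n : Fin N) (μ ν : ℂ) : lax p η n (μ + ν) = μ • 1 + lax p η n ν := by
  refine Matrix.ext fun α β => ?_
  have h : siteLax (p n) η (μ + ν) α β =
      (μ * if α = β then 1 else 0) • 1 + siteLax (p n) η ν α β := by
    simp only [siteLax]
    module
  rw [Matrix.add_apply, lax_apply, lax_apply, h, ← actHom_apply, ← actHom_apply, map_add,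
    map_smul, map_one, Matrix.smul_apply, Matrix.one_apply]
  split_ifs <;> simp

/-- The monodromy matrix built on arbitrary local factors. -/
def chainMonodromy (W : Fin N → Matrix (Fin 2) (Fin 2) (Op p)) : Matrix (Fin 2) (Fin 2) (Op p) :=
  K.map (fun c => c • (1 : Op p)) * (List.ofFn W).reverse.prod

lemma monodromy_eq (ξ : Fin N → ℂ) (μ : ℂ) :
    monodromy p η K ξ μ = chainMonodromy p K fun n => lax p η n (μ - ξ n) := rfl

lemma chainMonodromy_smul (c : Fin N → ℂ) (W : Fin N → Matrix (Fin 2) (Fin 2) (Op p)) :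
    chainMonodromy p K (fun n => c n • W n) = (∏ n, c n) • chainMonodromy p K W := by
  rw [chainMonodromy, List.prod_reverse_ofFn_smul, mul_smul_comm, chainMonodromy]

section Poly

variable {σ : Type}

lemma IsPoly.lax (n : Fin N) {f : (σ → ℂ) → ℂ} (hf : IsPoly f) :
    IsPoly fun x => lax p η n (f x) := by
  have h : ∀ x, HigherSpin.lax p η n (f x) =
      f x • (1 : Matrix (Fin 2) (Fin 2) (Op p)) + HigherSpin.lax p η n 0 := by
    intro x
    rw [← lax_add, add_zero]
  simp only [h]
  exact (hf.smul (IsPoly.const _)).add (IsPoly.const _)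

lemma IsPoly.chainMonodromy {W : Fin N → (σ → ℂ) → Matrix (Fin 2) (Fin 2) (Op p)}
    (hW : ∀ n, IsPoly (W n)) : IsPoly fun x => chainMonodromy p K fun n => W n x :=
  (IsPoly.const _).mul (IsPoly.prod_reverse_ofFn hW)

lemma IsPoly.symTrace {a : ℕ} {M : Fin a → (σ → ℂ) → Matrix (Fin 2) (Fin 2) (Op p)}
    (hM : ∀ i, IsPoly (M i)) : IsPoly fun x => symTrace p fun i => M i x :=
  IsPoly.sum _ fun β _ => IsPoly.sum _ fun α _ => (IsPoly.const _).smul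
    (IsPoly.prod_ofFn fun i => (hM i).entry (α i) (β i))

lemma IsPoly.sub_coord {f g : (σ → ℂ) → ℂ} (hf : IsPoly f) (hg : IsPoly g) :
    IsPoly fun x => f x - g x := by
  simp only [sub_eq_add_neg, ← neg_one_mul (g _)]
  exact hf.add ((IsPoly.const (-1 : ℂ)).mul hg)

lemma IsPoly.monodromy {ξ : (σ → ℂ) → Fin N → ℂ} (hξ : ∀ n, IsPoly fun x => ξ x n)
    {f : (σ → ℂ) → ℂ} (hf : IsPoly f) : IsPoly fun x => monodromy p η K (ξ x) (f x) := by
  simp only [monodromy_eq]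
  exact IsPoly.chainMonodromy p K fun n => IsPoly.lax p η n (hf.sub_coord (hξ n))

lemma IsPoly.fusedTransfer {ξ : (σ → ℂ) → Fin N → ℂ} (hξ : ∀ n, IsPoly fun x => ξ x n) (a : ℕ)
    {f : (σ → ℂ) → ℂ} (hf : IsPoly f) : IsPoly fun x => fusedTransfer p η K (ξ x) a (f x) := by
  simp only [fusedTransfer_eq_symTrace]
  exact IsPoly.symTrace p fun i => IsPoly.monodromy p η K hξ (hf.add (IsPoly.const _))

lemma IsPoly.vecMul_apply {ι : Type} [Fintype ι] {S : (σ → ℂ) → ι → ℂ}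
    (hS : ∀ i, IsPoly fun x => S x i) {M : (σ → ℂ) → Matrix ι ι ℂ} (hM : IsPoly M) (j : ι) :
    IsPoly fun x => (S x ᵥ* M x) j :=
  IsPoly.sum _ fun i _ => (hS i).mul (hM.entry i j)

lemma IsPoly.sovCovector {ξ : (σ → ℂ) → Fin N → ℂ} (hξ : ∀ n, IsPoly fun x => ξ x n)
    {S : (σ → ℂ) → Idx p → ℂ} (hS : ∀ i, IsPoly fun x => S x i) (h g : Idx p) :
    IsPoly fun x => sovCovector p η K (ξ x) (S x) h g := by
  refine IsPoly.vecMul_apply hS (IsPoly.prod_ofFn fun n => IsPoly.pow ?_ _) g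
  refine IsPoly.fusedTransfer p η K hξ _ ?_
  simp only [shifted]
  exact ((hξ n).sub_coord (IsPoly.const _)).add (IsPoly.const _)

end Poly

/-- In the limit of widely separated inhomogeneities, the fused transfer matrix at the special
point of the site `n` becomes proportional to the fused twist of that site. -/
lemma exists_scaled_fusedTransfer (hη : η ≠ 0) {d : Fin N → ℂ} (hd : Function.Injective d)
    (n : Fin N) :
    ∃ F : (Unit → ℂ) → Op p, IsPoly F ∧
      (∃ c : ℂ, c ≠ 0 ∧ F 0 = c • actOn n (fusedTwist K (p n))) ∧
      ∀ s : ℂ, s ≠ 0 → ∃ e : ℂ, e ≠ 0 ∧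
        fusedTransfer p η K (fun k => s⁻¹ * d k) (p n)
          (shifted η (s⁻¹ * d n) (p n) ((p n : ℤ) - 1)) = e • F fun _ => s := by
  -- These are the arguments of the Lax operators of site `n` inside the fused product, namely the
  -- Capelli points.
  set c : Fin (p n) → ℂ := fun i => (((p n : ℕ) : ℂ) / 2 - 1 / 2 - ((i : ℕ) : ℂ)) * η with hc
  set δ : Fin N → ℂ := fun k => if k = n then 1 else d n - d k with hδ
  have hδ0 : (∏ k, δ k) ≠ 0 := by
    refine Finset.prod_ne_zero_iff.2 fun k _ => ?_
    simp only [hδ]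
    split_ifs with h
    · exact one_ne_zero
    · exact sub_ne_zero.2 fun h' => h (hd h').symm
  -- Away from site `n` the Lax operator has been multiplied by `s`, which makes it polynomial in
  -- `s` with scalar value at `s = 0`; site `n` is not rescaled.
  set W : ℂ → ℂ → Fin N → Matrix (Fin 2) (Fin 2) (Op p) := fun μ s k =>
    if k = n then lax p η k μ else (d n - d k) • 1 + s • lax p η k μ with hW
  refine ⟨fun x => symTrace p fun i => chainMonodromy p K (W (c i) (x ())), ?_, ?_, ?_⟩
  · refine IsPoly.symTrace p (M := fun i x => chainMonodromy p K (W (c i) (x ()))) fun i =>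
      IsPoly.chainMonodromy p K (W := fun k x => W (c i) (x ()) k) fun k => ?_
    simp only [hW]
    split_ifs
    · exact IsPoly.const _
    · exact (IsPoly.const _).add ((IsPoly.coord ()).smul (IsPoly.const _))
  · refine ⟨(∏ k, δ k) ^ p n * (η ^ p n * (p n).factorial),
      mul_ne_zero (pow_ne_zero _ hδ0) (mul_ne_zero (pow_ne_zero _ hη)
        (Nat.cast_ne_zero.2 (Nat.factorial_ne_zero _))), ?_⟩
    have h0 : ∀ i, chainMonodromy p K (W (c i) 0) =
        (∏ k, δ k) • (K.map (fun c => c • (1 : Op p)) * lax p η n (c i)) := by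
      intro i
      have e : W (c i) 0 = fun k => δ k • (if k = n then lax p η n (c i) else 1) := by
        funext k
        simp only [hW, hδ]
        split_ifs with h
        · rw [h, one_smul]
        · rw [zero_smul, add_zero]
      rw [e, chainMonodromy_smul, chainMonodromy, List.prod_reverse_ofFn_eq_single n]
      · simp
      · intro k hk
        simp [hk]
    simp only [Pi.zero_apply, h0]
    rw [symTrace_smul, mul_smul]
    congr 1
    rw [← actHom_apply, ← map_smul, ← fused_siteLax, map_sum, symTrace]
    refine Finset.sum_congr rfl fun β _ => ?_
    -- Expanding each factor `K L` separates the entries of `K`; they form the tensor power that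
    -- completes the two projectors to `projTwist`.
    have e1 : ∀ α : Fin (p n) → Fin 2, (List.ofFn fun i =>
        (K.map (fun c => c • (1 : Op p)) * lax p η n (c i)) (α i) (β i)).prod =
        ∑ γ : Fin (p n) → Fin 2, (∏ i, K (α i) (γ i)) • actHom n
          (List.ofFn fun i => siteLax (p n) η (c i) (γ i) (β i)).prod := by
      intro α
      simp only [Matrix.mul_apply, List.prod_ofFn_sum, Matrix.map_apply, smul_mul_assoc, one_mul,
        List.prod_ofFn_smul, lax_apply]
      refine Finset.sum_congr rfl fun γ _ => ?_
      rw [map_list_prod, List.map_ofFn]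
      rfl
    simp only [e1, Finset.smul_sum, smul_smul, map_sum, map_smul]
    rw [Finset.sum_comm]
    refine Finset.sum_congr rfl fun γ _ => ?_
    rw [← Finset.sum_smul, projTwist, ← Matrix.mul_assoc, Matrix.mul_apply]
    simp only [tensorPow_apply]
    rfl
  · intro s hs
    -- Scalars removed from each monodromy factor: `s⁻¹` for every site other than `n`.
    set τ : Fin N → ℂ := fun k => if k = n then 1 else s⁻¹ with hτ
    have hτ0 : (∏ k, τ k) ≠ 0 := by
      refine Finset.prod_ne_zero_iff.2 fun k _ => ?_
      simp only [hτ]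
      split_ifs
      · exact one_ne_zero
      · exact inv_ne_zero hs
    refine ⟨(∏ k, τ k) ^ p n, pow_ne_zero _ hτ0, ?_⟩
    rw [fusedTransfer_eq_symTrace, ← symTrace_smul]
    congr 1
    funext i
    rw [monodromy_eq, ← chainMonodromy_smul]
    congr 1
    funext k
    have e : shifted η (s⁻¹ * d n) (p n) ((p n : ℤ) - 1) +
        ((p n : ℂ) - 1 - ((i : ℕ) : ℂ)) * η - s⁻¹ * d k = s⁻¹ * (d n - d k) + c i := by
      simp only [shifted, hc]
      push_cast
      ring
    rw [e]
    simp only [hW, hτ]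
    split_ifs with h
    · rw [h, sub_self, mul_zero, zero_add, one_smul]
    · rw [lax_add, smul_add, smul_smul, smul_smul, inv_mul_cancel₀ hs, one_smul]

/-! ### Generic nonvanishing of the determinant of the covectors -/

variable {p}

/-- The determinant of the family of covectors. -/
def sovDet (ξ : Fin N → ℂ) (S : Idx p → ℂ) : ℂ :=
  (Matrix.of fun h : Idx p => sovCovector p η K ξ S h).det

lemma isCovectorBasis_sovCovector (ξ : Fin N → ℂ) (S : Idx p → ℂ) :
    IsCovectorBasis (sovCovector p η K ξ S) ↔ sovDet η K ξ S ≠ 0 :=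
  isCovectorBasis_iff _

/-- Polynomiality in `s` of the rescaled family moves nonvanishing from the decoupled limit to an
actual chain. -/
lemma exists_sovDet_ne_zero (hη : η ≠ 0) {S : ∀ n : Fin N, Fin (p n + 1) → ℂ}
    (hS : ∀ n, IsLocalGenerator K (p n) (S n)) :
    ∃ ξ : Fin N → ℂ, sovDet η K ξ (tensorCovector S) ≠ 0 := by
  have hd : Function.Injective fun k : Fin N => ((k : ℕ) : ℂ) := fun i j h =>
    Fin.ext (Nat.cast_injective (R := ℂ) h)
  choose F hF hF0 hFs using exists_scaled_fusedTransfer p η K hη hd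
  choose c hc hF0 using hF0
  set G : (Unit → ℂ) → Matrix (Idx p) (Idx p) ℂ := fun x => Matrix.of fun h =>
    tensorCovector S ᵥ* (List.ofFn fun n => F n x ^ (h n : ℕ)).prod with hG
  have hpoly : IsPoly fun x => (G x).det := IsPoly.det fun h g =>
    IsPoly.vecMul_apply (S := fun _ => tensorCovector S) (fun i => IsPoly.const _)
      (IsPoly.prod_ofFn fun n => (hF n).pow (h n)) g
  have h0 : (G 0).det ≠ 0 := by
    -- In the limit the operators are one-site fused twists, so the family is a tensor product of
    -- local families, up to nonzero factors on the rows.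
    have e : G 0 = Matrix.of fun h g => (∏ n, c n ^ (h n : ℕ)) *
        tensorOp (fun n => Matrix.of fun k : Fin (p n + 1) =>
          S n ᵥ* fusedTwist K (p n) ^ (k : ℕ)) h g := by
      ext h g
      simp only [hG, of_apply, hF0, _root_.smul_pow, ← actHom_apply, ← map_pow]
      rw [List.prod_ofFn_smul, vecMul_smul]
      simp only [actHom_apply]
      rw [prod_actOn, tensorCovector_vecMul]
      rfl
    rw [e, det_mul_column]
    refine mul_ne_zero (Finset.prod_ne_zero_iff.2 fun h _ => Finset.prod_ne_zero_iff.2 fun n _ =>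
      pow_ne_zero _ (hc n)) ?_
    rw [← isUnit_iff_ne_zero, ← Matrix.isUnit_iff_isUnit_det]
    refine isUnit_tensorOp fun n => ?_
    rw [Matrix.isUnit_iff_isUnit_det, isUnit_iff_ne_zero]
    exact (isCovectorBasis_iff _).1 (hS n)
  obtain ⟨s, hs, hs'⟩ := hpoly.exists_ne_zero h0
  refine ⟨fun k => s⁻¹ * ((k : ℕ) : ℂ), ?_⟩
  have hFs' := fun n => hFs n s hs
  choose e he hes using hFs'
  have e1 : (Matrix.of fun h : Idx p => sovCovector p η K (fun k => s⁻¹ * ((k : ℕ) : ℂ))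
      (tensorCovector S) h) =
      Matrix.of fun h g => (∏ n, e n ^ (h n : ℕ)) * G (fun _ => s) h g := by
    ext h g
    simp only [of_apply, sovCovector, hes, _root_.smul_pow, hG]
    rw [List.prod_ofFn_smul, vecMul_smul]
    rfl
  rw [sovDet, e1, det_mul_column]
  exact mul_ne_zero (Finset.prod_ne_zero_iff.2 fun h _ => Finset.prod_ne_zero_iff.2 fun n _ =>
      pow_ne_zero _ (he n)) hs'

lemma exists_sov_polynomial (hη : η ≠ 0) {S : ∀ n : Fin N, Fin (p n + 1) → ℂ}
    (hS : ∀ n, IsLocalGenerator K (p n) (S n)) :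
    ∃ Q : MvPolynomial (Fin N) ℂ, Q ≠ 0 ∧ ∀ ξ : Fin N → ℂ, MvPolynomial.eval ξ Q ≠ 0 →
      IsCovectorBasis (sovCovector p η K ξ (tensorCovector S)) := by
  have hpoly : IsPoly fun ξ : Fin N → ℂ => sovDet η K ξ (tensorCovector S) :=
    IsPoly.det fun h g => IsPoly.sovCovector p η K (ξ := fun ξ => ξ)
      (S := fun _ => tensorCovector S) (fun n => IsPoly.coord n) (fun i => IsPoly.const _) h g
  obtain ⟨Q, hQ⟩ := hpoly.exists_eval
  obtain ⟨ξ, hξ⟩ := exists_sovDet_ne_zero η K hη hS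
  refine ⟨Q, ?_, fun ξ hξ => ?_⟩
  · rintro rfl
    exact hξ (by rw [← hQ, map_zero])
  · rwa [isCovectorBasis_sovCovector, ← hQ]

/-- With the covector also free, a tensor product of local generators remains an admissible point of
nonvanishing. -/
lemma exists_sov_polynomial_joint (hη : η ≠ 0)
    (hS : ∀ n, ∃ S : Fin (p n + 1) → ℂ, IsLocalGenerator K (p n) S) :
    ∃ P : MvPolynomial (Fin N ⊕ Idx p) ℂ, P ≠ 0 ∧ ∀ (ξ : Fin N → ℂ) (S : Idx p → ℂ),
      MvPolynomial.eval (Sum.elim ξ S) P ≠ 0 → IsCovectorBasis (sovCovector p η K ξ S) := by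
  have hpoly : IsPoly fun x : Fin N ⊕ Idx p → ℂ =>
      sovDet η K (fun n => x (Sum.inl n)) (fun i => x (Sum.inr i)) :=
    IsPoly.det fun h g => IsPoly.sovCovector p η K (fun n => IsPoly.coord _)
      (fun i => IsPoly.coord _) h g
  obtain ⟨P, hP⟩ := hpoly.exists_eval
  choose S hS using hS
  obtain ⟨ξ, hξ⟩ := exists_sovDet_ne_zero η K hη hS
  refine ⟨P, ?_, fun ξ S h => ?_⟩
  · rintro rfl
    have := hP (Sum.elim ξ (tensorCovector S))
    rw [map_zero] at this
    exact hξ this.symm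
  · rw [hP] at h
    exact (isCovectorBasis_sovCovector η K ξ S).2 h

end Chain

/-! ### Matrices with simple spectrum -/

section SimpleSpectrum

variable {ι : Type} [Fintype ι] [DecidableEq ι]

/-- `A` is diagonalizable with pairwise distinct eigenvalues. -/
def HasSimpleSpectrum (A : Matrix ι ι ℂ) : Prop :=
  ∃ (B : Matrix ι ι ℂ) (t : ι → ℂ), IsUnit B.det ∧ A * B = B * diagonal t ∧ Function.Injective t

lemma exists_diagonalization {A : Matrix ι ι ℂ} {t : ι → ℂ} (ht : Function.Injective t)
    (v : ι → ι → ℂ) (hv : ∀ i, v i ≠ 0) (h : ∀ i, A *ᵥ v i = t i • v i) :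
    ∃ B : Matrix ι ι ℂ, IsUnit B.det ∧ A * B = B * diagonal t := by
  have hli : LinearIndependent ℂ v := Module.End.eigenvectors_linearIndependent' (toLin' A) t ht v
    fun i => ⟨Module.End.mem_eigenspace_iff.2 (by rw [toLin'_apply, h]), hv i⟩
  refine ⟨(Matrix.of v)ᵀ, ?_, ?_⟩
  · rw [← Matrix.isUnit_iff_isUnit_det, ← linearIndependent_cols_iff_isUnit]
    exact hli
  · ext i j
    rw [mul_diagonal, Matrix.mul_apply]
    have := congrFun (h j) i
    simp only [Pi.smul_apply, smul_eq_mul, mulVec, dotProduct] at this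
    simp only [transpose_apply, of_apply, this, mul_comm]

lemma HasSimpleSpectrum.smul_one_add_smul {A : Matrix ι ι ℂ} (hA : HasSimpleSpectrum A) (b : ℂ)
    {a : ℂ} (ha : a ≠ 0) : HasSimpleSpectrum (b • 1 + a • A) := by
  obtain ⟨B, t, hB, h, ht⟩ := hA
  refine ⟨B, fun i => b + a * t i, hB, ?_, fun i j hij => ?_⟩
  · rw [add_mul, smul_mul_assoc, smul_mul_assoc, h, one_mul]
    ext i j
    simp only [Matrix.add_apply, Matrix.smul_apply, mul_diagonal, smul_eq_mul]
    ring
  · exact ht (mul_left_cancel₀ ha (add_left_cancel hij))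

/-- The Hankel matrix of the traces of the powers of `A`. -/
def traceHankel (A : Matrix ι ι ℂ) : Matrix (Fin (Fintype.card ι)) (Fin (Fintype.card ι)) ℂ :=
  Matrix.of fun i j => (A ^ ((i : ℕ) + (j : ℕ))).trace

/-- The Hankel matrix is `Vᵀ * V`, with `V` the Vandermonde matrix of the eigenvalues. -/
lemma HasSimpleSpectrum.det_traceHankel_ne_zero {A : Matrix ι ι ℂ} (hA : HasSimpleSpectrum A) :
    (traceHankel A).det ≠ 0 := by
  obtain ⟨B, t, hB, h, ht⟩ := hA
  have htr : ∀ k, (A ^ k).trace = ∑ i, t i ^ k := by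
    intro k
    have h1 : SemiconjBy B (diagonal t) A := h.symm
    have h2 : B * diagonal t ^ k = A ^ k * B := h1.pow_right k
    have h3 : A ^ k = B * diagonal t ^ k * B⁻¹ := by
      rw [h2, Matrix.mul_assoc, mul_nonsing_inv _ hB, Matrix.mul_one]
    rw [h3, Matrix.trace_mul_comm, ← Matrix.mul_assoc, nonsing_inv_mul _ hB, Matrix.one_mul,
      diagonal_pow, trace_diagonal]
    rfl
  set V := vandermonde (t ∘ (Fintype.equivFin ι).symm) with hV
  have e : traceHankel A = Vᵀ * V := by
    ext i j
    simp only [traceHankel, of_apply, htr, Matrix.mul_apply, transpose_apply, hV,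
      vandermonde_apply, ← pow_add]
    exact (Equiv.sum_comp (Fintype.equivFin ι).symm fun k => t k ^ ((i : ℕ) + (j : ℕ))).symm
  have hV0 : V.det ≠ 0 := det_vandermonde_ne_zero_iff.2 (ht.comp (Equiv.injective _))
  rw [e, det_mul, det_transpose]
  exact mul_ne_zero hV0 hV0

/-- If the characteristic polynomial is `a * a * q`, then `a * q` evaluated at `A` squares to zero
by Cayley–Hamilton. Its products with powers of `A` are nilpotent, hence traceless. If `a` is not a
unit, the coefficients of `a * q` give a nonzero kernel vector of the Hankel matrix. -/
lemma squarefree_charpoly {A : Matrix ι ι ℂ} (hA : (traceHankel A).det ≠ 0) :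
    Squarefree A.charpoly := by
  intro a ha
  by_contra hu
  obtain ⟨q, hq⟩ := ha
  have h0 : A.charpoly ≠ 0 := (charpoly_monic A).ne_zero
  have ha0 : a ≠ 0 := by rintro rfl; simp at hq; exact h0 hq
  have hr0 : a * q ≠ 0 := fun h => h0 (by rw [hq, mul_assoc, h, mul_zero])
  have hdeg : (a * q).natDegree < Fintype.card ι := by
    have h1 : A.charpoly.natDegree = a.natDegree + (a * q).natDegree := by
      rw [hq, mul_assoc, natDegree_mul ha0 hr0]
    rw [charpoly_natDegree_eq_dim] at h1
    have h2 : 0 < a.natDegree := by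
      rw [Nat.pos_iff_ne_zero]
      intro h
      exact hu (Polynomial.isUnit_iff_degree_eq_zero.2 (by rw [degree_eq_natDegree ha0, h]; rfl))
    omega
  have hnil : IsNilpotent (aeval A (a * q)) := by
    refine ⟨2, ?_⟩
    rw [← map_pow, show (a * q) ^ 2 = A.charpoly * q by rw [hq]; ring, map_mul,
      aeval_self_charpoly, zero_mul]
  refine hr0 ?_
  have hv : (fun j : Fin (Fintype.card ι) => (a * q).coeff j) = 0 := by
    refine eq_zero_of_mulVec_eq_zero hA (funext fun i => ?_)
    have h1 : traceHankel A *ᵥ (fun j : Fin (Fintype.card ι) => (a * q).coeff j) =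
        fun i : Fin (Fintype.card ι) => (A ^ (i : ℕ) * aeval A (a * q)).trace := by
      funext i
      rw [aeval_eq_sum_range' hdeg, Finset.mul_sum, trace_sum, ← Fin.sum_univ_eq_sum_range
        (fun k => (A ^ (i : ℕ) * (a * q).coeff k • A ^ k).trace)]
      simp only [mulVec, dotProduct, traceHankel, of_apply, mul_smul_comm, trace_smul, ← pow_add,
        smul_eq_mul, mul_comm]
    rw [h1]
    have hcomm : Commute (A ^ (i : ℕ)) (aeval A (a * q)) := by
      have := Commute.all (X ^ (i : ℕ)) (a * q)
      simpa using this.map (aeval A)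
    exact (isNilpotent_trace_of_isNilpotent (hcomm.isNilpotent_mul_left hnil)).eq_zero
  ext k
  by_cases hk : k < Fintype.card ι
  · exact congrFun hv ⟨k, hk⟩
  · exact coeff_eq_zero_of_natDegree_lt (by omega)

/-- Over `ℂ` a squarefree characteristic polynomial has as many distinct roots as the dimension. -/
lemma HasSimpleSpectrum.of_det_traceHankel {A : Matrix ι ι ℂ} (hA : (traceHankel A).det ≠ 0) :
    HasSimpleSpectrum A := by
  have hsq := squarefree_charpoly hA
  have hnd : A.charpoly.roots.Nodup := nodup_roots (PerfectField.separable_iff_squarefree.2 hsq)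
  have hcard : A.charpoly.roots.toFinset.card = Fintype.card ι := by
    rw [Multiset.toFinset_card_of_nodup hnd, ← (IsAlgClosed.splits _).natDegree_eq_card_roots,
      charpoly_natDegree_eq_dim]
  have e : ι ≃ A.charpoly.roots.toFinset := Fintype.equivOfCardEq (by simp [hcard])
  have hroot : ∀ i, ∃ v : ι → ℂ, v ≠ 0 ∧ A *ᵥ v = (e i : ℂ) • v := by
    intro i
    have h1 : A.charpoly.IsRoot (e i : ℂ) :=
      (mem_roots'.1 (Multiset.mem_toFinset.1 (e i).2)).2
    rw [IsRoot.def, eval_charpoly, ← exists_mulVec_eq_zero_iff] at h1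
    obtain ⟨v, hv, h⟩ := h1
    refine ⟨v, hv, ?_⟩
    rw [sub_mulVec, sub_eq_zero] at h
    rw [← h]
    simp
  choose v hv h using hroot
  have ht : Function.Injective fun i => (e i : ℂ) := Subtype.val_injective.comp e.injective
  obtain ⟨B, hB, hAB⟩ := exists_diagonalization ht v hv h
  exact ⟨B, _, hB, hAB, ht⟩

end SimpleSpectrum

/-- Take the covector with all coordinates `1` in the dual eigenbasis: its iterates form a
transposed Vandermonde matrix. -/
lemma HasSimpleSpectrum.exists_covectorBasis {m : ℕ} {A : Matrix (Fin (m + 1)) (Fin (m + 1)) ℂ}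
    (hA : HasSimpleSpectrum A) :
    ∃ S : Fin (m + 1) → ℂ, IsCovectorBasis fun h : Fin (m + 1) => S ᵥ* A ^ (h : ℕ) := by
  obtain ⟨B, t, hB, h, ht⟩ := hA
  refine ⟨(fun _ => 1) ᵥ* B⁻¹, (isCovectorBasis_iff _).2 fun hdet => ?_⟩
  have e : Matrix.of (fun h : Fin (m + 1) => ((fun _ => (1 : ℂ)) ᵥ* B⁻¹) ᵥ* A ^ (h : ℕ)) * B =
      (vandermonde t)ᵀ := by
    ext k j
    have h1 : SemiconjBy B (diagonal t) A := h.symm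
    have h2 : B * diagonal t ^ (k : ℕ) = A ^ (k : ℕ) * B := h1.pow_right k
    have h3 : ((((fun _ => (1 : ℂ)) ᵥ* B⁻¹) ᵥ* A ^ (k : ℕ)) ᵥ* B) j = t j ^ (k : ℕ) := by
      rw [vecMul_vecMul, ← h2, vecMul_vecMul, ← Matrix.mul_assoc, nonsing_inv_mul _ hB,
        Matrix.one_mul, diagonal_pow, vecMul_diagonal]
      simp
    rw [transpose_apply, vandermonde_apply, ← h3]
    rfl
  have h0 := congrArg det e
  rw [det_mul, hdet, zero_mul, det_transpose] at h0
  exact det_vandermonde_ne_zero_iff.2 ht h0.symm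

/-! ### Eigenvectors as products of linear forms -/

/-- The linear form with given coefficients. -/
def linForm (u : Fin 2 → ℂ) : MvPolynomial (Fin 2) ℂ := ∑ b, u b • MvPolynomial.X b

lemma linForm_ne_zero {u : Fin 2 → ℂ} (hu : u ≠ 0) : linForm u ≠ 0 := by
  intro h
  refine hu (funext fun a => ?_)
  have h2 := congrArg (MvPolynomial.coeff (Finsupp.single a 1)) h
  rw [linForm, MvPolynomial.coeff_sum, Finset.sum_eq_single a] at h2
  · simpa using h2
  · intro b _ hb
    rw [MvPolynomial.coeff_smul, MvPolynomial.coeff_X, if_neg, smul_zero]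
    simpa [Finsupp.single_left_inj] using hb
  · simp

lemma isHomogeneous_linForm (u : Fin 2 → ℂ) : (linForm u).IsHomogeneous 1 := by
  refine MvPolynomial.IsHomogeneous.sum _ _ _ fun b _ => ?_
  rw [MvPolynomial.smul_eq_C_mul]
  simpa using (MvPolynomial.isHomogeneous_C (Fin 2) (u b)).mul (MvPolynomial.isHomogeneous_X ℂ b)

/-- The eigenforms have degree `m`, hence pull back to vectors; distinct eigenvalues give their
independence. -/
lemma Intertwines.exists_diagonalization {m : ℕ} {A : Matrix (Fin (m + 1)) (Fin (m + 1)) ℂ}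
    {O : Module.End ℂ (MvPolynomial (Fin 2) ℂ)} (hA : Intertwines m A O) {u v : Fin 2 → ℂ}
    (hu : u ≠ 0) (hv : v ≠ 0) {t : Fin (m + 1) → ℂ} (ht : Function.Injective t)
    (h : ∀ j : Fin (m + 1), O (linForm u ^ (m - j) * linForm v ^ (j : ℕ)) =
      t j • (linForm u ^ (m - j) * linForm v ^ (j : ℕ))) :
    ∃ B : Matrix (Fin (m + 1)) (Fin (m + 1)) ℂ, IsUnit B.det ∧ A * B = B * diagonal t := by
  have hw : ∀ j : Fin (m + 1), ∃ w, toForm m w = linForm u ^ (m - j) * linForm v ^ (j : ℕ) := by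
    intro j
    refine mem_range_toForm ?_
    have := ((isHomogeneous_linForm u).pow (m - j)).mul ((isHomogeneous_linForm v).pow (j : ℕ))
    have e : 1 * (m - (j : ℕ)) + 1 * (j : ℕ) = m := by omega
    rwa [e] at this
  choose w hw using hw
  have hw0 : ∀ j, w j ≠ 0 := by
    intro j h0
    have := hw j
    rw [h0, map_zero] at this
    exact mul_ne_zero (pow_ne_zero _ (linForm_ne_zero hu)) (pow_ne_zero _ (linForm_ne_zero hv))
      this.symm
  have hAw : ∀ j, A *ᵥ w j = t j • w j := fun j => toForm_injective m (by
    rw [hA, hw, h, map_smul, hw])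
  exact HigherSpin.exists_diagonalization ht w hw0 hAw

lemma substForm_linForm (K : Matrix (Fin 2) (Fin 2) ℂ) (u : Fin 2 → ℂ) :
    substForm K (linForm u) = linForm (K *ᵥ u) := by
  simp only [linForm, map_sum, map_smul, substForm, MvPolynomial.aeval_X, mulVec, dotProduct,
    Finset.smul_sum, Finset.sum_smul, smul_smul]
  rw [Finset.sum_comm]
  simp only [mul_comm]

lemma linForm_smul (c : ℂ) (u : Fin 2 → ℂ) : linForm (c • u) = c • linForm u := by
  simp only [linForm, Finset.smul_sum, smul_smul, Pi.smul_apply, smul_eq_mul]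

/-- The eigenvalues are `k₁ ^ (m - j) * k₂ ^ j`. After cancelling nonzero factors, a coincidence of
two of them is an equality of `k₁ ^ r` and `k₂ ^ r` with `1 ≤ r ≤ m`. -/
lemma hasSimpleSpectrum_fusedTwist {K : Matrix (Fin 2) (Fin 2) ℂ} {k₁ k₂ : ℂ} {u v : Fin 2 → ℂ}
    (hu : u ≠ 0) (hv : v ≠ 0) (hKu : K *ᵥ u = k₁ • u) (hKv : K *ᵥ v = k₂ • v) (h₁ : k₁ ≠ 0)
    (h₂ : k₂ ≠ 0) {m : ℕ} (hk : ∀ j : ℕ, 1 ≤ j → j ≤ m → k₁ ^ j ≠ k₂ ^ j) :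
    HasSimpleSpectrum (fusedTwist K m) := by
  have ht : Function.Injective fun j : Fin (m + 1) => k₁ ^ (m - (j : ℕ)) * k₂ ^ (j : ℕ) := by
    have key : ∀ i j : Fin (m + 1), i < j →
        k₁ ^ (m - (i : ℕ)) * k₂ ^ (i : ℕ) ≠ k₁ ^ (m - (j : ℕ)) * k₂ ^ (j : ℕ) := by
      intro i j hij h
      have hij' : (i : ℕ) < j := hij
      refine hk (j - i) (by omega) (by omega) ?_
      have e1 : k₁ ^ (m - (i : ℕ)) = k₁ ^ (m - (j : ℕ)) * k₁ ^ ((j : ℕ) - i) := by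
        rw [← pow_add]; congr 1; omega
      have e2 : k₂ ^ (j : ℕ) = k₂ ^ ((j : ℕ) - i) * k₂ ^ (i : ℕ) := by
        rw [← pow_add]; congr 1; omega
      rw [e1, e2, ← mul_assoc] at h
      exact mul_left_cancel₀ (pow_ne_zero _ h₁) (mul_right_cancel₀ (pow_ne_zero _ h₂) h)
    intro i j h
    rcases lt_trichotomy i j with hij | hij | hij
    · exact absurd h (key i j hij)
    · exact hij
    · exact absurd h.symm (key j i hij)
  obtain ⟨B, hB, h⟩ := (intertwines_fusedTwist K m).exists_diagonalization hu hv ht fun j => by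
    rw [AlgHom.toLinearMap_apply, map_mul, map_pow, map_pow, substForm_linForm, substForm_linForm,
      hKu, hKv, linForm_smul, linForm_smul, _root_.smul_pow, _root_.smul_pow, smul_mul_smul_comm]
  exact ⟨B, _, hB, h, ht⟩

/-- The derivation of binary forms which extends `K`. -/
def twistDeriv (K : Matrix (Fin 2) (Fin 2) ℂ) : Module.End ℂ (MvPolynomial (Fin 2) ℂ) :=
  ∑ α, ∑ β, K α β • formGen β α

lemma twistDeriv_mul (K : Matrix (Fin 2) (Fin 2) ℂ) (f g : MvPolynomial (Fin 2) ℂ) :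
    twistDeriv K (f * g) = twistDeriv K f * g + f * twistDeriv K g := by
  simp only [twistDeriv, LinearMap.add_apply, LinearMap.smul_apply, formGen_apply,
    Fin.sum_univ_two, MvPolynomial.pderiv_mul, MvPolynomial.smul_eq_C_mul]
  ring

lemma twistDeriv_linForm (K : Matrix (Fin 2) (Fin 2) ℂ) (u : Fin 2 → ℂ) :
    twistDeriv K (linForm u) = linForm (K *ᵥ u) := by
  have h1 : MvPolynomial.pderiv (1 : Fin 2) (MvPolynomial.X 0 : MvPolynomial (Fin 2) ℂ) = 0 :=
    MvPolynomial.pderiv_X_of_ne (by decide)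
  have h0 : MvPolynomial.pderiv (0 : Fin 2) (MvPolynomial.X 1 : MvPolynomial (Fin 2) ℂ) = 0 :=
    MvPolynomial.pderiv_X_of_ne (by decide)
  simp only [twistDeriv, LinearMap.add_apply, LinearMap.smul_apply, formGen_apply, linForm,
    Fin.sum_univ_two, map_add, MvPolynomial.pderiv_C_mul, h0, h1, MvPolynomial.pderiv_X_self, mulVec,
    dotProduct, MvPolynomial.smul_eq_C_mul, map_mul]
  ring

lemma twistDeriv_linForm_pow {K : Matrix (Fin 2) (Fin 2) ℂ} {u : Fin 2 → ℂ} {k : ℂ}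
    (h : K *ᵥ u = k • u) (a : ℕ) :
    twistDeriv K (linForm u ^ a) = (a * k) • linForm u ^ a := by
  induction a with
  | zero =>
    simp [twistDeriv, formGen_apply]
  | succ a ih =>
    rw [pow_succ, twistDeriv_mul, ih, twistDeriv_linForm, h, linForm_smul, smul_mul_assoc,
      mul_smul_comm, ← add_smul]
    push_cast
    congr 1
    ring

/-- The first order of the transfer matrix at the site `n`. -/
def siteTwist (m : ℕ) (η : ℂ) (K : Matrix (Fin 2) (Fin 2) ℂ) :
    Matrix (Fin (m + 1)) (Fin (m + 1)) ℂ :=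
  ∑ α, ∑ β, K α β • siteLax m η 0 β α

/-- Up to a scalar, the operator is `η` times the derivation extending `K`. A derivation adds
eigenvalues where a substitution multiplies them, so `k₁ ≠ k₂` alone separates them. -/
lemma exists_diagonalization_siteTwist {K : Matrix (Fin 2) (Fin 2) ℂ} {k₁ k₂ : ℂ}
    {u v : Fin 2 → ℂ} (hu : u ≠ 0) (hv : v ≠ 0) (hKu : K *ᵥ u = k₁ • u) (hKv : K *ᵥ v = k₂ • v)
    (hk : k₁ ≠ k₂) {η : ℂ} (hη : η ≠ 0) (m : ℕ) :
    ∃ (B : Matrix (Fin (m + 1)) (Fin (m + 1)) ℂ) (c : ℂ), IsUnit B.det ∧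
      siteTwist m η K * B = B * diagonal fun j : Fin (m + 1) => c + (η * (k₂ - k₁)) * ((j : ℕ) : ℂ) := by
  have hI : Intertwines m (siteTwist m η K)
      (((η / 2 - η * m / 2) * (K 0 0 + K 1 1)) • 1 + η • twistDeriv K) := by
    have e : ((η / 2 - η * m / 2) * (K 0 0 + K 1 1)) • 1 + η • twistDeriv K =
        ∑ α, ∑ β, K α β • (((0 + η / 2 - η * m / 2) * if β = α then 1 else 0) • 1 +
          η • formGen β α) := by
      simp only [twistDeriv, Fin.sum_univ_two]
      simp
      module
    rw [e]
    exact Intertwines.sum _ fun α => Intertwines.sum _ fun β => Intertwines.smul _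
      ((Intertwines.one.smul _).add ((intertwines_spinGen m β α).smul η))
  have ht : Function.Injective fun j : Fin (m + 1) =>
      ((η / 2 - η * m / 2) * (K 0 0 + K 1 1) + η * m * k₁) +
        (η * (k₂ - k₁)) * ((j : ℕ) : ℂ) := fun i j h =>
    Fin.ext (Nat.cast_injective (R := ℂ)
      (mul_left_cancel₀ (mul_ne_zero hη (sub_ne_zero.2 hk.symm)) (add_left_cancel h)))
  obtain ⟨B, hB, h⟩ := hI.exists_diagonalization hu hv ht fun j => by
    have hj : (j : ℕ) ≤ m := Nat.lt_succ_iff.1 j.2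
    rw [LinearMap.add_apply, LinearMap.smul_apply, LinearMap.smul_apply, twistDeriv_mul,
      twistDeriv_linForm_pow hKu, twistDeriv_linForm_pow hKv, Module.End.one_apply,
      smul_mul_assoc, mul_smul_comm, Nat.cast_sub hj]
    module
  exact ⟨B, _, hB, h⟩

/-! ### Commutation of the transfer matrices -/

section YangBaxter

variable {R : Type} [Ring R] [Algebra ℂ R]

/-- The exchange relation of the rational `R`-matrix `c + η P` in components. -/
def ExchangeRel (c η : ℂ) (A B : Matrix (Fin 2) (Fin 2) R) : Prop :=
  ∀ i j k l, c • (A i j * B k l) + η • (A k j * B i l) = c • (B k l * A i j) + η • (B k j * A i l)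

/-- This says that `K ⊗ K` commutes with the flip. -/
lemma ExchangeRel.scalar (c η : ℂ) (K : Matrix (Fin 2) (Fin 2) ℂ) :
    ExchangeRel c η (K.map fun x => x • (1 : R)) (K.map fun x => x • (1 : R)) := by
  intro i j k l
  simp only [Matrix.map_apply, smul_mul_smul_comm, mul_one, mul_comm (K i j)]

/-- The usual comultiplication argument: commuting entries allow the pairs `A, B` and `A', B'` to be
grouped, and the `R`-matrix passes through one pair after the other. -/
lemma ExchangeRel.mul {c η : ℂ} {A B A' B' : Matrix (Fin 2) (Fin 2) R} (h : ExchangeRel c η A B)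
    (h' : ExchangeRel c η A' B') (hAB : ∀ i j k l, Commute (A i j) (B' k l))
    (hBA : ∀ i j k l, Commute (B i j) (A' k l)) : ExchangeRel c η (A * A') (B * B') := by
  have h1 : ∀ i j k l a b, A i a * A' a j * (B k b * B' b l) = A i a * B k b * (A' a j * B' b l) :=
    fun i j k l a b => by
      rw [mul_assoc, ← mul_assoc (A' a j), ← (hBA k b a j).eq]
      simp only [mul_assoc]
  have h2 : ∀ i j k l a b, B k b * B' b l * (A i a * A' a j) = B k b * A i a * (B' b l * A' a j) :=
    fun i j k l a b => by
      rw [mul_assoc, ← mul_assoc (B' b l), ← (hAB i a b l).eq]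
      simp only [mul_assoc]
  intro i j k l
  have e1 : c • ((A * A') i j * (B * B') k l) + η • ((A * A') k j * (B * B') i l) =
      ∑ a, ∑ b, (c • (A i a * B k b) + η • (A k a * B i b)) * (A' a j * B' b l) := by
    simp only [Matrix.mul_apply, Finset.sum_mul_sum, h1, Finset.smul_sum,
      ← Finset.sum_add_distrib, add_mul, smul_mul_assoc]
  have e2 : c • ((B * B') k l * (A * A') i j) + η • ((B * B') k j * (A * A') i l) =
      ∑ a, ∑ b, B k b * A i a * (c • (B' b l * A' a j) + η • (B' b j * A' a l)) := by
    simp only [Matrix.mul_apply, Finset.sum_mul_sum, h2, Finset.smul_sum,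
      ← Finset.sum_add_distrib, mul_add, mul_smul_comm]
    rw [Finset.sum_comm]
  -- In the `η` terms the flip is transferred from one pair to the other by renaming the contracted
  -- indices.
  have e3 : ∑ a, ∑ b, B k b * A i a * (c • (B' b l * A' a j) + η • (B' b j * A' a l)) =
      ∑ a, ∑ b, (c • (B k b * A i a) + η • (B k a * A i b)) * (A' a j * B' b l) := by
    have e4 : ∀ a b, c • (B' b l * A' a j) + η • (B' b j * A' a l) =
        c • (A' a j * B' b l) + η • (A' b j * B' a l) := fun a b => (h' a j b l).symm
    simp only [e4, mul_add, add_mul, mul_smul_comm, smul_mul_assoc, Finset.sum_add_distrib]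
    congr 1
    rw [Finset.sum_comm]
  rw [e1, e2, e3]
  refine Finset.sum_congr rfl fun a _ => Finset.sum_congr rfl fun b _ => ?_
  rw [h i a k b]

/-- Contracting the relation directly and after a flip gives `c x = -η y` and `c y = -η x`; the
determinant of this system is `c ^ 2 - η ^ 2`. -/
lemma ExchangeRel.commute_trace {c η : ℂ} {A B : Matrix (Fin 2) (Fin 2) R}
    (h : ExchangeRel c η A B) (hc : c ^ 2 ≠ η ^ 2) : Commute A.trace B.trace := by
  set x : R := A.trace * B.trace - B.trace * A.trace with hx
  set y : R := ∑ i, ∑ k, (A k i * B i k - B i k * A k i) with hy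
  have h1 : c • x = -(η • y) := by
    have e : c • x + η • y = ∑ i, ∑ k, ((c • (A i i * B k k) + η • (A k i * B i k)) -
        (c • (B k k * A i i) + η • (B k i * A i k))) := by
      simp only [hx, hy, Matrix.trace, Matrix.diag_apply, Fin.sum_univ_two, mul_add, add_mul]
      module
    rw [eq_neg_iff_add_eq_zero, e]
    simp only [h _ _ _ _, sub_self, Finset.sum_const_zero]
  have h2 : c • y = -(η • x) := by
    have e : c • y + η • x = ∑ i, ∑ k, ((c • (A k i * B i k) + η • (A i i * B k k)) -
        (c • (B i k * A k i) + η • (B i i * A k k))) := by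
      simp only [hx, hy, Matrix.trace, Matrix.diag_apply, Fin.sum_univ_two, mul_add, add_mul]
      module
    rw [eq_neg_iff_add_eq_zero, e]
    simp only [h _ _ _ _, sub_self, Finset.sum_const_zero]
  have h3 : (c ^ 2 - η ^ 2) • x = 0 := by
    rw [sub_smul, pow_two, pow_two, mul_smul, mul_smul, h1, smul_neg, smul_comm, h2, smul_neg,
      neg_neg, sub_self]
  exact sub_eq_zero.1 ((smul_eq_zero.1 h3).resolve_left (sub_ne_zero.2 hc))

lemma commute_entry_list_prod {R : Type} [Ring R] {x : R} {l : List (Matrix (Fin 2) (Fin 2) R)}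
    (h : ∀ M ∈ l, ∀ i j, Commute x (M i j)) (i j : Fin 2) : Commute x (l.prod i j) := by
  induction l generalizing i j with
  | nil =>
    rw [List.prod_nil, Matrix.one_apply]
    split_ifs
    · exact Commute.one_right x
    · exact Commute.zero_right x
  | cons M l ih =>
    rw [List.prod_cons, Matrix.mul_apply]
    exact Commute.sum_right _ _ _ fun k _ => (h M (by simp) i k).mul_right
      (ih (fun M' hM' => h M' (by simp [hM'])) k j)

lemma ExchangeRel.list_prod {ι : Type} {c η : ℂ} {A B : ι → Matrix (Fin 2) (Fin 2) R}
    (h : ∀ n, ExchangeRel c η (A n) (B n))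
    (hAB : ∀ m n, m ≠ n → ∀ i j k l, Commute (A m i j) (B n k l)) (s : List ι) (hs : s.Nodup) :
    ExchangeRel c η (s.map A).prod (s.map B).prod := by
  induction s with
  | nil =>
    have := ExchangeRel.scalar (R := R) c η 1
    have e : ((1 : Matrix (Fin 2) (Fin 2) ℂ).map fun x => x • (1 : R)) = 1 := by
      ext i j
      simp only [Matrix.map_apply, Matrix.one_apply]
      split_ifs <;> simp
    rwa [e] at this
  | cons n s ih =>
    rw [List.nodup_cons] at hs
    rw [List.map_cons, List.map_cons, List.prod_cons, List.prod_cons]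
    refine (h n).mul (ih hs.2) (fun i j k l => commute_entry_list_prod ?_ k l)
      (fun i j k l => commute_entry_list_prod ?_ k l)
    · intro M hM i' j'
      obtain ⟨m, hm, rfl⟩ := List.mem_map.1 hM
      exact hAB n m (fun e => hs.1 (e ▸ hm)) _ _ _ _
    · intro M hM i' j'
      obtain ⟨m, hm, rfl⟩ := List.mem_map.1 hM
      exact (hAB m n (fun e => hs.1 (e ▸ hm)) _ _ _ _).symm

end YangBaxter

/-! ### The `gl₂` relations and the exchange relation along the chain -/

lemma formGen_commutator (i j k l : Fin 2) :
    formGen i j * formGen k l - formGen k l * formGen i j =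
      (if i = l then (1 : ℂ) else 0) • formGen k j - (if k = j then (1 : ℂ) else 0) • formGen i l := by
  refine LinearMap.ext fun f => ?_
  have hd : ∀ a b : Fin 2, MvPolynomial.pderiv a (MvPolynomial.X b : MvPolynomial (Fin 2) ℂ) =
      if a = b then 1 else 0 := by
    intro a b
    rw [MvPolynomial.pderiv_X, Pi.single_apply]
    simp only [eq_comm]
  have hc : MvPolynomial.pderiv i (MvPolynomial.pderiv k f) =
      MvPolynomial.pderiv k (MvPolynomial.pderiv i f) := by
    have h : ⁅MvPolynomial.pderiv (R := ℂ) i, MvPolynomial.pderiv (R := ℂ) k⁆ = 0 := by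
      refine MvPolynomial.derivation_ext fun a => ?_
      rw [Derivation.commutator_apply, hd, hd]
      split_ifs <;> simp
    have h2 := DFunLike.congr_fun h f
    rw [Derivation.commutator_apply] at h2
    exact sub_eq_zero.1 h2
  simp only [LinearMap.sub_apply, LinearMap.smul_apply, Module.End.mul_apply, formGen_apply,
    MvPolynomial.pderiv_mul, hd, hc]
  split_ifs <;> simp <;> ring

lemma spinGen_commutator (m : ℕ) (i j k l : Fin 2) :
    spinGen m i j * spinGen m k l - spinGen m k l * spinGen m i j =
      (if i = l then (1 : ℂ) else 0) • spinGen m k j -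
        (if k = j then (1 : ℂ) else 0) • spinGen m i l := by
  have h := intertwines_spinGen m
  refine Intertwines.eq ((h i j).mul (h k l) |>.sub ((h k l).mul (h i j))) ?_
  rw [formGen_commutator]
  exact ((h k j).smul _).sub ((h i l).smul _)

/-- For Lax operators linear in the generators, the exchange relation is the `gl₂` commutation
relation. -/
lemma exchangeRel_siteLax (m : ℕ) (η x y : ℂ) :
    ExchangeRel (x - y) η (Matrix.of (siteLax m η x)) (Matrix.of (siteLax m η y)) := by
  intro i j k l
  have h := spinGen_commutator m i j k l
  rw [sub_eq_iff_eq_add] at h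
  simp only [of_apply, siteLax, add_mul, mul_add, smul_mul_assoc, mul_smul_comm, one_mul, mul_one]
  rw [h]
  module

section Chain

variable {N : ℕ} (p : Fin N → ℕ) (η : ℂ) (K : Matrix (Fin 2) (Fin 2) ℂ)

lemma exchangeRel_lax (n : Fin N) (x y : ℂ) :
    ExchangeRel (x - y) η (lax p η n x) (lax p η n y) := by
  intro i j k l
  have h := congrArg (actHom n) (exchangeRel_siteLax (p n) η x y i j k l)
  simp only [map_add, map_smul, map_mul, of_apply] at h
  simpa only [lax_apply, actHom_apply] using h

lemma exchangeRel_monodromy (ξ : Fin N → ℂ) (x y : ℂ) :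
    ExchangeRel (x - y) η (monodromy p η K ξ x) (monodromy p η K ξ y) := by
  have hscal : ∀ (i j : Fin 2) (X : Op p), Commute (K.map (fun c => c • (1 : Op p)) i j) X :=
    fun i j X => (Commute.one_left X).smul_left (K i j)
  rw [monodromy_eq, monodromy_eq, chainMonodromy, chainMonodromy]
  refine (ExchangeRel.scalar _ _ K).mul ?_ (fun i j k l => hscal i j _)
    (fun i j k l => hscal i j _)
  rw [List.ofFn_eq_map, List.ofFn_eq_map, ← List.map_reverse, ← List.map_reverse]
  refine ExchangeRel.list_prod (fun n => ?_) (fun m n hmn i j k l => ?_) _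
    (List.nodup_reverse.2 (List.nodup_finRange N))
  · have := exchangeRel_lax p η n (x - ξ n) (y - ξ n)
    rwa [sub_sub_sub_cancel_right] at this
  · rw [lax_apply, lax_apply]
    exact actOn_commute hmn _ _

lemma IsPoly.continuous {f : (Unit → ℂ) → ℂ} (hf : IsPoly f) : Continuous fun s => f fun _ => s := by
  obtain ⟨P, hP⟩ := hf.exists_eval
  simp only [← hP]
  exact (MvPolynomial.continuous_eval P).comp (continuous_pi fun _ => continuous_id)

lemma isPoly_transfer {σ : Type} {ξ : (σ → ℂ) → Fin N → ℂ} (hξ : ∀ n, IsPoly fun x => ξ x n)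
    {f : (σ → ℂ) → ℂ} (hf : IsPoly f) : IsPoly fun x => transfer p η K (ξ x) (f x) :=
  (IsPoly.monodromy p η K hξ hf).trace

/-- The transfer matrices form a commuting family. -/
lemma transfer_commute (ξ : Fin N → ℂ) (x y : ℂ) :
    Commute (transfer p η K ξ x) (transfer p η K ξ y) := by
  have hcont : Continuous fun y => transfer p η K ξ y := by
    refine continuous_matrix fun i j => ?_
    exact ((isPoly_transfer p η K (σ := Unit) (ξ := fun _ => ξ) (fun n => IsPoly.const _)
      (IsPoly.coord ())).entry i j).continuous
  have hclosed : IsClosed {y | transfer p η K ξ x * transfer p η K ξ y =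
      transfer p η K ξ y * transfer p η K ξ x} :=
    isClosed_eq (continuous_const.mul hcont) (hcont.mul continuous_const)
  -- The trace argument misses only `y = x ± η`; continuity fills in these two points.
  have hdense : Dense ({x - η, x + η} : Set ℂ)ᶜ :=
    (Set.toFinite _).countable.dense_compl ℂ
  have hsub : ({x - η, x + η} : Set ℂ)ᶜ ⊆ {y | transfer p η K ξ x * transfer p η K ξ y =
      transfer p η K ξ y * transfer p η K ξ x} := by
    intro y hy
    refine (exchangeRel_monodromy p η K ξ x y).commute_trace fun h => hy ?_
    rcases sq_eq_sq_iff_eq_or_eq_neg.1 h with h | h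
    · left; linear_combination -h
    · right; exact Set.mem_singleton_iff.2 (by linear_combination -h)
  exact (hdense.closure_eq ▸ hclosed.closure_subset_iff.2 hsub) (Set.mem_univ y)

/-! ### Simplicity of the spectrum -/

/-- What commutes with a diagonal matrix with distinct entries is diagonal, so the eigenbasis at `0`
serves all `μ`. The conjugating matrix is constant, so eigenvalues are polynomial in `μ`, and their
values at `0` already distinguish them. -/
lemma isDiagonalizableSimple_of_hasSimpleSpectrum {ξ : Fin N → ℂ}
    (h : HasSimpleSpectrum (transfer p η K ξ 0)) : IsDiagonalizableSimple (transfer p η K ξ) := by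
  obtain ⟨B, t, hB, hBt, ht⟩ := h
  set D : ℂ → Op p := fun μ => B⁻¹ * transfer p η K ξ μ * B with hD
  have hTB : ∀ μ, transfer p η K ξ μ * B = B * D μ := by
    intro μ
    rw [hD, ← Matrix.mul_assoc, ← Matrix.mul_assoc, mul_nonsing_inv _ hB, Matrix.one_mul]
  have hD0 : D 0 = diagonal t := by
    rw [hD]
    simp only
    rw [Matrix.mul_assoc, hBt, ← Matrix.mul_assoc, nonsing_inv_mul _ hB, Matrix.one_mul]
  have hDD : ∀ x y, D x * D y = B⁻¹ * (transfer p η K ξ x * transfer p η K ξ y) * B := by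
    intro x y
    simp only [hD]
    rw [Matrix.mul_assoc (B⁻¹ * _) B, ← Matrix.mul_assoc B, ← Matrix.mul_assoc B,
      mul_nonsing_inv _ hB, Matrix.one_mul]
    simp only [Matrix.mul_assoc]
  have hdiag : ∀ μ i j, i ≠ j → D μ i j = 0 := by
    intro μ i j hij
    have hcomm : D 0 * D μ = D μ * D 0 := by
      rw [hDD, hDD, (transfer_commute p η K ξ 0 μ).eq]
    have h := congrFun (congrFun hcomm i) j
    rw [hD0, diagonal_mul, mul_diagonal] at h
    have h2 : (t i - t j) * D μ i j = 0 := by linear_combination h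
    exact (mul_eq_zero.1 h2).resolve_left (sub_ne_zero.2 fun e => hij (ht e))
  have hpoly : ∀ i, ∃ q : ℂ[X], ∀ μ, q.eval μ = D μ i i := by
    intro i
    have h1 : IsPoly fun x : Unit → ℂ => D (x ()) i i :=
      (((IsPoly.const B⁻¹).mul (isPoly_transfer p η K (σ := Unit) (ξ := fun _ => ξ)
        (fun n => IsPoly.const _) (IsPoly.coord ()))).mul (IsPoly.const B)).entry i i
    obtain ⟨P, hP⟩ := h1.exists_eval
    refine ⟨MvPolynomial.aeval (fun _ => X) P, fun μ => ?_⟩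
    rw [← hP fun _ => μ, ← Polynomial.coe_aeval_eq_eval, ← MvPolynomial.coe_aeval_eq_eval]
    have e : (Polynomial.aeval μ).comp (MvPolynomial.aeval fun _ : Unit => (X : ℂ[X])) =
        MvPolynomial.aeval fun _ : Unit => μ := MvPolynomial.algHom_ext fun _ => by simp
    exact DFunLike.congr_fun e P
  choose q hq using hpoly
  have hli : LinearIndependent ℂ B.col :=
    linearIndependent_cols_iff_isUnit.2 ((Matrix.isUnit_iff_isUnit_det B).2 hB)
  refine ⟨basisOfLinearIndependentOfCardEqFinrank' _ hli (by simp), q, fun i μ => ?_, fun i j h => ?_⟩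
  · rw [coe_basisOfLinearIndependentOfCardEqFinrank']
    ext f
    have h := congrFun (congrFun (hTB μ) f) i
    rw [Matrix.mul_apply, Matrix.mul_apply, Finset.sum_eq_single (f := fun j => B f j * D μ j i) i
      (fun j _ hj => by rw [hdiag μ j i hj, mul_zero]) (by simp)] at h
    rw [Pi.smul_apply, smul_eq_mul, hq, mul_comm]
    exact h
  · apply ht
    have h1 := hq i 0
    have h2 := hq j 0
    rw [hD0, diagonal_apply_eq] at h1 h2
    rw [← h1, ← h2, h]

/-! ### First-order expansion at large inhomogeneities -/

variable {p}

lemma actOn_diagonal (n : Fin N) (d : Fin (p n + 1) → ℂ) :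
    (actOn n (diagonal d) : Op p) = diagonal fun f : Idx p => d (f n) := by
  ext f g
  simp only [actOn, of_apply, Matrix.diagonal_apply]
  by_cases h : f = g
  · simp [h]
  · rw [if_neg h]
    split_ifs with h1 h2
    · exfalso
      refine h (funext fun j => ?_)
      by_cases hj : j = n
      · subst hj; exact h2
      · exact h1 j hj
    · rfl
    · rfl

lemma sum_actOn_mul_tensorOp {A B : ∀ n, Matrix (Fin (p n + 1)) (Fin (p n + 1)) ℂ}
    {t : ∀ n, Fin (p n + 1) → ℂ} (h : ∀ n, A n * B n = B n * diagonal (t n)) (z : Fin N → ℂ) :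
    (∑ n, z n • (actOn n (A n) : Op p)) * tensorOp B =
      tensorOp B * diagonal fun f : Idx p => ∑ n, z n * t n (f n) := by
  have h1 : ∀ n, (actOn n (A n) : Op p) * tensorOp B =
      tensorOp B * actOn n (diagonal (t n)) := by
    intro n
    rw [actOn_eq_tensorOp, actOn_eq_tensorOp, ← tensorOp_mul, ← tensorOp_mul]
    congr 1
    funext k
    rw [Pi.mul_apply, Pi.mul_apply]
    by_cases hk : k = n
    · subst hk; rw [Pi.mulSingle_eq_same, Pi.mulSingle_eq_same, h]
    · rw [Pi.mulSingle_eq_of_ne hk, Pi.mulSingle_eq_of_ne hk, one_mul, mul_one]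
  have h2 : (diagonal fun f : Idx p => ∑ n, z n * t n (f n)) =
      ∑ n, z n • (actOn n (diagonal (t n)) : Op p) := by
    ext f g
    simp only [actOn_diagonal, Matrix.sum_apply, Matrix.smul_apply, Matrix.diagonal_apply,
      smul_eq_mul]
    split_ifs <;> simp
  rw [h2, Finset.sum_mul, Finset.mul_sum]
  refine Finset.sum_congr rfl fun n _ => ?_
  rw [smul_mul_assoc, mul_smul_comm, h1]

/-- The expansion of a product of factors close to the identity. -/
lemma exists_prod_one_add_smul {R : Type} [Ring R] [Algebra ℂ R] (l : List R) :
    ∃ F : (Unit → ℂ) → R, IsPoly F ∧ F 0 = l.sum ∧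
      ∀ s : ℂ, (l.map fun C => 1 + s • C).prod = 1 + s • F fun _ => s := by
  induction l with
  | nil => exact ⟨fun _ => 0, IsPoly.const 0, by simp, by simp⟩
  | cons C l ih =>
    obtain ⟨F, hF, hF0, hFs⟩ := ih
    refine ⟨fun x => (C + F x) + x () • (C * F x), ?_, ?_, fun s => ?_⟩
    · exact ((IsPoly.const C).add hF).add ((IsPoly.coord ()).smul ((IsPoly.const C).mul hF))
    · simp [hF0]
    · rw [List.map_cons, List.prod_cons, hFs, add_mul, one_mul, mul_add, mul_one, smul_mul_assoc,
        mul_smul_comm]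
      simp only [smul_add]
      abel

/-- Integer weights separating the configurations. -/
lemma injective_sum_weight (p : Fin N → ℕ) :
    ∃ M : ℕ, 0 < M ∧ Function.Injective fun f : Idx p => ∑ n : Fin N, (f n : ℕ) * M ^ (n : ℕ) := by
  have hle : ∀ n, p n + 1 ≤ 1 + ∑ k, p k := fun n => by
    have := Finset.single_le_sum (fun k _ => Nat.zero_le (p k)) (Finset.mem_univ n)
    omega
  refine ⟨1 + ∑ k, p k, by omega, fun f g h => ?_⟩
  have h1 : (fun n => Fin.castLE (hle n) (f n)) = fun n => Fin.castLE (hle n) (g n) := by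
    apply finFunctionFinEquiv.injective
    apply Fin.ext
    rw [finFunctionFinEquiv_apply, finFunctionFinEquiv_apply]
    exact h
  funext n
  exact Fin.castLE_injective (hle n) (congrFun h1 n)

/-- Simplicity cannot be read at leading order, where the transfer matrix is scalar; it appears at
first order in `s`. -/
lemma exists_hasSimpleSpectrum_transfer (hη : η ≠ 0) {k₁ k₂ : ℂ} {u v : Fin 2 → ℂ}
    (hu : u ≠ 0) (hv : v ≠ 0) (hKu : K *ᵥ u = k₁ • u) (hKv : K *ᵥ v = k₂ • v) (hk : k₁ ≠ k₂) :
    ∃ ξ : Fin N → ℂ, HasSimpleSpectrum (transfer p η K ξ 0) := by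
  obtain ⟨M, hM, hinj⟩ := injective_sum_weight p
  set z : Fin N → ℂ := fun n => (M : ℂ) ^ (n : ℕ) with hz
  have hz0 : ∀ n, z n ≠ 0 := fun n => pow_ne_zero _ (Nat.cast_ne_zero.2 hM.ne')
  obtain ⟨F, hF, hF0, hFs⟩ := exists_prod_one_add_smul
    (List.ofFn fun n => z n • lax p η n 0).reverse
  set G : (Unit → ℂ) → Op p := fun x => (K.map (fun c => c • (1 : Op p)) * F x).trace with hG
  have hGpoly : IsPoly G := ((IsPoly.const _).mul hF).trace
  have hG0 : G 0 = ∑ n, z n • actOn n (siteTwist (p n) η K) := by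
    simp only [hG]
    rw [hF0, List.sum_reverse, List.sum_ofFn, Finset.mul_sum, trace_sum]
    refine Finset.sum_congr rfl fun n _ => ?_
    rw [mul_smul_comm, trace_smul, siteTwist, ← actHom_apply]
    simp only [map_sum, map_smul, Matrix.trace, Matrix.diag_apply, Matrix.mul_apply,
      Matrix.map_apply, smul_mul_assoc, one_mul, lax_apply, actHom_apply]
  have hsimple : HasSimpleSpectrum (G 0) := by
    choose B c hB hBc using fun n =>
      exists_diagonalization_siteTwist hu hv hKu hKv hk hη (p n)
    refine ⟨tensorOp B, fun f => ∑ n, z n * (c n + (η * (k₂ - k₁)) * ((f n : ℕ) : ℂ)),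
      ?_, ?_, ?_⟩
    rotate_left
    · rw [hG0]
      exact sum_actOn_mul_tensorOp hBc z
    · intro f g h
      apply hinj
      simp only [mul_add, Finset.sum_add_distrib, add_right_inj] at h
      have e : ∀ f : Idx p, ∑ n, z n * (η * (k₂ - k₁) * ((f n : ℕ) : ℂ)) =
          (η * (k₂ - k₁)) * ((∑ n : Fin N, (f n : ℕ) * M ^ (n : ℕ) : ℕ) : ℂ) := by
        intro f
        push_cast
        rw [Finset.mul_sum]
        refine Finset.sum_congr rfl fun n _ => ?_
        simp only [hz]
        ring
      rw [e, e] at h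
      exact_mod_cast mul_left_cancel₀ (mul_ne_zero hη (sub_ne_zero.2 hk.symm)) h
    · rw [← Matrix.isUnit_iff_isUnit_det]
      exact isUnit_tensorOp fun n => (Matrix.isUnit_iff_isUnit_det _).2 (hB n)
  have hHpoly : IsPoly fun x => (traceHankel (G x)).det :=
    IsPoly.det fun i j => (hGpoly.pow _).trace
  obtain ⟨s, hs, hs'⟩ := hHpoly.exists_ne_zero hsimple.det_traceHankel_ne_zero
  -- Chosen so that the Lax operator of site `n` at `0` is proportional to `1 + s • (z n • lax p η n
  -- 0)`.
  refine ⟨fun n => -((z n)⁻¹ * s⁻¹), ?_⟩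
  have e1 : ∀ n, lax p η n (0 - -((z n)⁻¹ * s⁻¹)) =
      ((z n)⁻¹ * s⁻¹) • (1 + s • (z n • lax p η n 0)) := by
    intro n
    rw [zero_sub, neg_neg, smul_add, smul_smul, smul_smul, inv_mul_cancel_right₀ hs,
      inv_mul_cancel₀ (hz0 n), one_smul, ← lax_add, add_zero]
  have e2 : transfer p η K (fun n => -((z n)⁻¹ * s⁻¹)) 0 =
      ((∏ n, (z n)⁻¹ * s⁻¹) * K.trace) • 1 + ((∏ n, (z n)⁻¹ * s⁻¹) * s) • G fun _ => s := by
    rw [transfer, monodromy_eq]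
    simp only [e1]
    rw [chainMonodromy_smul, chainMonodromy, trace_smul]
    have e3 : (List.ofFn fun n => 1 + s • (z n • lax p η n 0)).reverse =
        (List.ofFn fun n => z n • lax p η n 0).reverse.map fun C => 1 + s • C := by
      rw [List.map_reverse, List.map_ofFn]
      rfl
    rw [e3, hFs, mul_add, mul_one, trace_add, mul_smul_comm, trace_smul, smul_add, mul_smul,
      mul_smul]
    congr 2
    simp only [Matrix.trace, Matrix.diag_apply, Matrix.map_apply, Finset.sum_smul]
  rw [e2]
  refine (HasSimpleSpectrum.of_det_traceHankel hs').smul_one_add_smul _ (mul_ne_zero ?_ hs)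
  exact Finset.prod_ne_zero_iff.2 fun n _ => mul_ne_zero (inv_ne_zero (hz0 n)) (inv_ne_zero hs)

lemma exists_diagonalizable_polynomial (p : Fin N → ℕ) (hη : η ≠ 0) {k₁ k₂ : ℂ} {u v : Fin 2 → ℂ}
    (hu : u ≠ 0) (hv : v ≠ 0) (hKu : K *ᵥ u = k₁ • u) (hKv : K *ᵥ v = k₂ • v) (hk : k₁ ≠ k₂) :
    ∃ Q : MvPolynomial (Fin N) ℂ, Q ≠ 0 ∧ ∀ ξ : Fin N → ℂ, MvPolynomial.eval ξ Q ≠ 0 →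
      IsDiagonalizableSimple (transfer p η K ξ) := by
  have hpoly : IsPoly fun ξ : Fin N → ℂ => (traceHankel (transfer p η K ξ 0)).det :=
    IsPoly.det fun i j => ((isPoly_transfer p η K (ξ := fun ξ => ξ) (fun n => IsPoly.coord n)
      (IsPoly.const 0)).pow _).trace
  obtain ⟨Q, hQ⟩ := hpoly.exists_eval
  obtain ⟨ξ, hξ⟩ := exists_hasSimpleSpectrum_transfer (p := p) η K hη hu hv hKu hKv hk
  refine ⟨Q, ?_, fun ξ hξ => ?_⟩
  · rintro rfl
    exact hξ.det_traceHankel_ne_zero (by rw [← hQ, map_zero])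
  · rw [hQ] at hξ
    exact isDiagonalizableSimple_of_hasSimpleSpectrum p η K (.of_det_traceHankel hξ)

end Chain

/-! ### Eigenvectors of the twist and conclusion -/

lemma exists_eigenvector {K : Matrix (Fin 2) (Fin 2) ℂ} {k : ℂ}
    (h : Module.End.HasEigenvalue (Matrix.toLin' K) k) : ∃ u : Fin 2 → ℂ, u ≠ 0 ∧ K *ᵥ u = k • u := by
  obtain ⟨u, hu⟩ := h.exists_hasEigenvector
  exact ⟨u, hu.2, by simpa using hu.apply_eq_smul⟩

lemma eigenvalue_ne_zero {K : Matrix (Fin 2) (Fin 2) ℂ} (hK : IsUnit K) {k : ℂ} {u : Fin 2 → ℂ}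
    (hu : u ≠ 0) (h : K *ᵥ u = k • u) : k ≠ 0 := by
  rintro rfl
  rw [zero_smul] at h
  exact hu (eq_zero_of_mulVec_eq_zero
    (isUnit_iff_ne_zero.1 ((Matrix.isUnit_iff_isUnit_det K).1 hK)) h)

end HigherSpin

end

/-- Here `p n = 2 s_n`, and "for almost any choice" means: outside the zero set of a nonzero
polynomial in the parameters concerned. -/
theorem proposition4p1 (N : ℕ) (p : Fin N → ℕ) (hp : ∀ n, 0 < p n) (η : ℂ) (hη : η ≠ 0)
    (K : Matrix (Fin 2) (Fin 2) ℂ) (k₁ k₂ : ℂ) (hk : k₁ ≠ k₂)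
    (hk₁ : Module.End.HasEigenvalue (Matrix.toLin' K) k₁)
    (hk₂ : Module.End.HasEigenvalue (Matrix.toLin' K) k₂)
    (hK : IsUnit K) :
    ((∀ n, ∀ j : ℕ, 1 ≤ j → j ≤ p n → k₁ ^ j ≠ k₂ ^ j) →
      (∃ P : MvPolynomial (Fin N ⊕ HigherSpin.Idx p) ℂ, P ≠ 0 ∧
        ∀ (ξ : Fin N → ℂ) (S : HigherSpin.Idx p → ℂ), HigherSpin.DistinctMod η ξ →
          MvPolynomial.eval (Sum.elim ξ S) P ≠ 0 →
            HigherSpin.IsCovectorBasis (HigherSpin.sovCovector p η K ξ S)) ∧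
      (∀ n, ∃ S : Fin (p n + 1) → ℂ, HigherSpin.IsLocalGenerator K (p n) S)) ∧
    (∀ S : ∀ n : Fin N, Fin (p n + 1) → ℂ,
      (∀ n, HigherSpin.IsLocalGenerator K (p n) (S n)) →
        ∃ Q : MvPolynomial (Fin N) ℂ, Q ≠ 0 ∧
          ∀ ξ : Fin N → ℂ, HigherSpin.DistinctMod η ξ → MvPolynomial.eval ξ Q ≠ 0 →
            HigherSpin.IsCovectorBasis
              (HigherSpin.sovCovector p η K ξ (HigherSpin.tensorCovector S))) ∧
    (∃ Q : MvPolynomial (Fin N) ℂ, Q ≠ 0 ∧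
      ∀ ξ : Fin N → ℂ, HigherSpin.DistinctMod η ξ → MvPolynomial.eval ξ Q ≠ 0 →
        HigherSpin.IsDiagonalizableSimple (HigherSpin.transfer p η K ξ)) := by
  obtain ⟨u, hu, hKu⟩ := HigherSpin.exists_eigenvector hk₁
  obtain ⟨v, hv, hKv⟩ := HigherSpin.exists_eigenvector hk₂
  have h₁ := HigherSpin.eigenvalue_ne_zero hK hu hKu
  have h₂ := HigherSpin.eigenvalue_ne_zero hK hv hKv
  refine ⟨fun hpow => ?_, fun S hS => ?_, ?_⟩
  · have hloc : ∀ n, ∃ S : Fin (p n + 1) → ℂ, HigherSpin.IsLocalGenerator K (p n) S := fun n =>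
      (HigherSpin.hasSimpleSpectrum_fusedTwist hu hv hKu hKv h₁ h₂ (hpow n)).exists_covectorBasis
    obtain ⟨P, hP, h⟩ := HigherSpin.exists_sov_polynomial_joint η K hη hloc
    exact ⟨⟨P, hP, fun ξ S _ => h ξ S⟩, hloc⟩
  · obtain ⟨Q, hQ, h⟩ := HigherSpin.exists_sov_polynomial η K hη hS
    exact ⟨Q, hQ, fun ξ _ => h ξ⟩
  · obtain ⟨Q, hQ, h⟩ := HigherSpin.exists_diagonalizable_polynomial η K p hη hu hv hKu hKv hk
    exact ⟨Q, hQ, fun ξ _ => h ξ⟩
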